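/- For an $n\times n$ $0$-$1$ matrix $C$ let $MWT(C)$ be the minimum weight of a spanning tree of the complete graph on the $n$ rows of $C$, where the edge between two rows has weight equal to their Hamming distance. $A_G$ denotes the adjacency matrix of a directed graph $G$, and $C^t$ the transpose of $C$. A \emph{combinatorial randomized algorithm} is a program for a random access machine with finitely many registers and two-dimensional arrays of natural numbers, built by sequencing, conditionals and while loops, whose only operations, each of unit cost, are: assigning a constant, copying, increment by $1$, decrement by $1$, indexed reading and writing of arrays, comparison of two registers, and flipping a fair coin. In particular no ring arithmetic (addition, subtraction or multiplication of two numbers) is available. The input is $n$ together with an $n\times n$ $0$-$1$ matrix stored in an array; the output is an $n\times n$ $0$-$1$ matrix stored in another array. For every real $\alpha\ge 1$ there are one such program and constants $C$ and $k$ such that the following holds for all $n\ge 1$. (i) For every directed graph $G$ on $n$ vertices (self-loops allowed), given by $A_G$, with probability at least $1-n^{-\alpha}$ over the coin flips the program halts within $$C\, n^{2}\sqrt{\,n+\min\{MWT(A_G),MWT(A_G^t)\}}\;\log^{k}(n+1)$$ steps, that is, in time $\widetilde O\bigl(n^{2}\sqrt{n+\min\{MWT(A_G),MWT(A_G^t)\}}\bigr)$,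 and outputs the adjacency matrix of the transitive closure of $G$, in which $(u,v)$ is an edge iff $G$ has a path with at least one edge from $u$ to $v$. (ii) Equivalently, for every $n\times n$ Boolean matrix $B$, with probability at least $1-n^{-\alpha}$ the program halts within $$C\, n^{2}\sqrt{\,n+\min\{MWT(B),MWT(B^t)\}}\;\log^{k}(n+1)$$ steps and outputs the transitive closure $B\vee B^2\vee B^3\vee\cdots$ of $B$ over the Boolean semiring. The same holds, with a possibly different program and constants, for the reflexive transitive closure: paths without edges are allowed in (i), and the output is $I\vee B\vee B^2\vee\cdots$ in (ii). -/

import Mathlib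

open MeasureTheory

/-! ### Boolean matrices, directed graphs and their transitive closures -/

/-- An `n × n` Boolean (0-1) matrix. -/
abbrev BoolMat (n : ℕ) : Type := Matrix (Fin n) (Fin n) Bool

namespace BoolMat

/-- The identity matrix over the Boolean semiring. -/
def one (n : ℕ) : BoolMat n := Matrix.of fun i j => decide (i = j)

/-- The product over the Boolean semiring `({0,1}, or, and)`. -/
def mul {n : ℕ} (B C : BoolMat n) : BoolMat n :=
  Matrix.of fun i j => decide (∃ k, B i k = true ∧ C k j = true)

/-- Powers over the Boolean semiring. -/
def pow {n : ℕ} (B : BoolMat n) : ℕ → BoolMat n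
  | 0 => one n
  | k + 1 => mul (pow B k) B

open Classical in
/-- The transitive closure `B⁺ = B ∨ B² ∨ B³ ∨ ⋯` over the Boolean semiring. -/
noncomputable def transClosure {n : ℕ} (B : BoolMat n) : BoolMat n :=
  Matrix.of fun i j => decide (∃ k, 1 ≤ k ∧ pow B k i j = true)

open Classical in
/-- The reflexive transitive closure `B* = I ∨ B ∨ B² ∨ ⋯` over the Boolean semiring. -/
noncomputable def reflTransClosure {n : ℕ} (B : BoolMat n) : BoolMat n :=
  Matrix.of fun i j => decide (∃ k, pow B k i j = true)

/-- The weight of a pair of (indices of) rows of `C`: the Hamming distance of the two rows. -/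
def rowWeight {n : ℕ} (C : BoolMat n) : Sym2 (Fin n) → ℕ :=
  Sym2.lift ⟨fun u v => hammingDist (C u) (C v), fun u v => hammingDist_comm (C u) (C v)⟩

open Classical in
/-- `MWT(C)`: the weight of a minimum weight spanning tree of the complete graph on the rows of
`C` in which an edge weighs the Hamming distance of its two end rows. -/
noncomputable def MWT {n : ℕ} (C : BoolMat n) : ℕ :=
  sInf {w | ∃ T : SimpleGraph (Fin n), T.IsTree ∧ w = ∑ e ∈ T.edgeFinset, rowWeight C e}

end BoolMat

open Classical in
/-- The adjacency matrix of a directed graph on the vertices `0, …, n - 1`. -/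
noncomputable def Digraph.boolAdj {n : ℕ} (G : Digraph (Fin n)) : BoolMat n :=
  Matrix.of fun u v => decide (G.Adj u v)

/-- The transitive closure of a directed graph: an edge `(u, v)` whenever there is a path with at
least one edge from `u` to `v`. -/
def Digraph.transClosure {V : Type*} (G : Digraph V) : Digraph V :=
  ⟨Relation.TransGen G.Adj⟩

/-- The reflexive transitive closure of a directed graph: an edge `(u, v)` whenever there is a
path, possibly without edges, from `u` to `v`. -/
def Digraph.reflTransClosure {V : Type*} (G : Digraph V) : Digraph V :=
  ⟨Relation.ReflTransGen G.Adj⟩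

/-! ### Combinatorial randomized random-access programs

Registers and array cells hold natural numbers. The only operations on numbers are constants,
copying, `+ 1`, `- 1` and comparison; in particular there is no addition, subtraction or
multiplication of two numbers (no ring arithmetic), and a computation of `t` steps can only produce
numbers that exceed the input size by at most `t` plus a constant, so that unit cost is realistic.
Randomness consists of independent fair coin flips. -/

/-- Tests on registers. -/
inductive RTest : Type
  | lt (x y : ℕ)
  | eq (x y : ℕ)

/-- Programs. Registers and two-dimensional arrays are named by natural numbers; a program mentions
only finitely many of them. -/
inductive RProg : Type
  /-- do nothing -/
  | skip
  /-- register `x` receives the constant `c` -/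
  | const (x c : ℕ)
  /-- register `x` receives the content of register `y` -/
  | copy (x y : ℕ)
  /-- increment register `x` -/
  | inc (x : ℕ)
  /-- decrement register `x` (0 stays 0) -/
  | dec (x : ℕ)
  /-- register `x` receives entry `(i, j)` of array `a`, with `i`, `j` the contents of the
  registers `y`, `z` -/
  | load (x a y z : ℕ)
  /-- entry `(i, j)` of array `a`, with `i`, `j` the contents of the registers `y`, `z`, receives
  the content of register `x` -/
  | store (a y z x : ℕ)
  /-- register `x` receives the outcome, 0 or 1, of a fresh fair coin flip -/
  | flip (x : ℕ)
  /-- sequential composition -/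
  | seq (p q : RProg)
  /-- conditional -/
  | ite (b : RTest) (p q : RProg)
  /-- loop -/
  | while (b : RTest) (p : RProg)

/-- A memory configuration: the registers, the two-dimensional arrays, and the number of coins
flipped so far. -/
structure RState : Type where
  reg : ℕ → ℕ
  arr : ℕ → ℕ → ℕ → ℕ
  coins : ℕ

namespace RState

/-- Overwrite a register. -/
def setReg (s : RState) (x v : ℕ) : RState :=
  { s with reg := Function.update s.reg x v }

/-- Overwrite a register by the outcome of a coin flip, and count the coin as used. -/
def flipReg (s : RState) (x : ℕ) (b : Bool) : RState :=
  { reg := Function.update s.reg x b.toNat, arr := s.arr, coins := s.coins + 1 }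

/-- Overwrite an array entry. -/
def setArr (s : RState) (a i j v : ℕ) : RState :=
  { reg := s.reg
    arr := Function.update s.arr a
      (Function.update (s.arr a) i (Function.update (s.arr a i) j v))
    coins := s.coins }

/-- The initial configuration on input `B`: register `0` holds `n`, array `0` holds the matrix, and
all the rest is zero. -/
def init {n : ℕ} (B : BoolMat n) : RState where
  reg := fun x => if x = 0 then n else 0
  arr := fun a i j =>
    if h : a = 0 ∧ i < n ∧ j < n then (B ⟨i, h.2.1⟩ ⟨j, h.2.2⟩).toNat else 0
  coins := 0

/-- The configuration holds the matrix `D` as the output, in array `1`. -/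
def Outputs {n : ℕ} (s : RState) (D : BoolMat n) : Prop :=
  ∀ i j : Fin n, s.arr 1 i j = (D i j).toNat

end RState

/-- Truth of a test in a configuration. -/
def RTest.Holds : RTest → RState → Prop
  | .lt x y, s => s.reg x < s.reg y
  | .eq x y, s => s.reg x = s.reg y

/-- `Exec ω p s t s'`: with the coin flips `ω`, the program `p` started in the configuration `s`
halts in the configuration `s'` after exactly `t` steps. Every elementary operation and every
evaluation of a test is one step. -/
inductive Exec (ω : ℕ → Bool) : RProg → RState → ℕ → RState → Prop
  | skip (s : RState) : Exec ω .skip s 1 s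
  | const (x c : ℕ) (s : RState) : Exec ω (.const x c) s 1 (s.setReg x c)
  | copy (x y : ℕ) (s : RState) : Exec ω (.copy x y) s 1 (s.setReg x (s.reg y))
  | inc (x : ℕ) (s : RState) : Exec ω (.inc x) s 1 (s.setReg x (s.reg x + 1))
  | dec (x : ℕ) (s : RState) : Exec ω (.dec x) s 1 (s.setReg x (s.reg x - 1))
  | load (x a y z : ℕ) (s : RState) :
      Exec ω (.load x a y z) s 1 (s.setReg x (s.arr a (s.reg y) (s.reg z)))
  | store (a y z x : ℕ) (s : RState) :
      Exec ω (.store a y z x) s 1 (s.setArr a (s.reg y) (s.reg z) (s.reg x))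
  | flip (x : ℕ) (s : RState) :
      Exec ω (.flip x) s 1 (s.flipReg x (ω s.coins))
  | seq {p q : RProg} {s s' s'' : RState} {t t' : ℕ} :
      Exec ω p s t s' → Exec ω q s' t' s'' → Exec ω (.seq p q) s (t + t') s''
  | ite_true {b : RTest} {p q : RProg} {s s' : RState} {t : ℕ} :
      b.Holds s → Exec ω p s t s' → Exec ω (.ite b p q) s (t + 1) s'
  | ite_false {b : RTest} {p q : RProg} {s s' : RState} {t : ℕ} :
      ¬ b.Holds s → Exec ω q s t s' → Exec ω (.ite b p q) s (t + 1) s'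
  | while_true {b : RTest} {p : RProg} {s s' s'' : RState} {t t' : ℕ} :
      b.Holds s → Exec ω p s t s' → Exec ω (.while b p) s' t' s'' →
      Exec ω (.while b p) s (t + 1 + t') s''
  | while_false {b : RTest} {p : RProg} {s : RState} :
      ¬ b.Holds s → Exec ω (.while b p) s 1 s

/-- The law of an infinite sequence of independent fair coin flips. -/
noncomputable def coinFlips : Measure (ℕ → Bool) :=
  Measure.infinitePi fun _ : ℕ => (PMF.uniformOfFintype Bool).toMeasure

/-- The probability, over the coin flips, that the program `P` on input `B` halts within `T` steps
with output `D`. -/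
noncomputable def successProb (P : RProg) {n : ℕ} (B D : BoolMat n) (T : ℝ) : ℝ :=
  coinFlips.real {ω | ∃ (t : ℕ) (s : RState),
    Exec ω P (RState.init B) t s ∧ (t : ℝ) ≤ T ∧ s.Outputs D}

/-- `C · n² · √(n + min {MWT(B), MWT(Bᵗ)}) · log(n+1)ᵏ`. -/
noncomputable def timeBound (C : ℝ) (k : ℕ) {n : ℕ} (B : BoolMat n) : ℝ :=
  C * ((n : ℝ) ^ 2 * √((n : ℝ) + (min B.MWT (BoolMat.MWT B.transpose) : ℕ)))
    * Real.log ((n : ℝ) + 1) ^ k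

/-!
The transitive closure is computed without using any coins. For thresholds `D = 1, 2, 4, …` the rows
of `B`, and then those of its transpose, are clustered greedily: a row that is farther than `D` from
all centers becomes a center, and more than `D` centers are a failure. Rows at pairwise distances
above `D` are centers of disjoint balls, hence a failure implies `D² ≤ 2 MWT`. After a success, the
out-neighbours of a vertex agree with those of a vertex of the same cluster that was processed
before, up to at most `2 D` listed columns. A search from one source therefore scans at most `D` full
rows and `O(n)` lists of length `D`, and the total cost is `O(n² D)`.
-/

/-! ### Weakest preconditions with exact running time -/

namespace RState

variable (s : RState)

/-! The algorithm is deterministic and always correct, so each success probability is one; the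
content is the running time `O(n² D)` at thresholds `D` that stay of order `1 + √min {MWT(B),
MWT(Bᵗ)}`.

Failure is informative. Rows at pairwise distances above `D` carry disjoint balls of radius about `D
/ 2`, and a spanning tree must pay for all of these radii but one (`sum_radius_le_sum_parent`,
`le_MWT_of_separated`). Hence `D + 1` such rows force `D² ≤ 2 MWT` (`le_MWT_of_scattered`). The
threshold is doubled only if both the rows and the columns fail, so the costs of the phases form a
geometric sum (`wp_transClosureProg`).

The search gains from clusters as follows (`wp_popRow`). If rows `i` and `f` of one cluster differ
in a column, then one of them differs there from the center, so the column is in one of two lists of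
length at most `D`. If all out-neighbours of `f` are marked, scanning these two lists for `i`
suffices. Only the first row popped from each of the at most `D` clusters needs a scan of all
columns; each of the at most `n + 1` pops otherwise costs `O(D)`. This is `O(n D)` per source.
Clustering the columns serves as well, because reversing a graph reverses its closure.

Running times are certified by potentials that pay for the steps of a loop (`wp_while`), and
`frame_of_exec` supplies what a program leaves unchanged. -/

@[simp] theorem setReg_reg (x v y : ℕ) : (s.setReg x v).reg y = if y = x then v else s.reg y := by
  simp [setReg, Function.update_apply]

@[simp] theorem setReg_arr (x v : ℕ) : (s.setReg x v).arr = s.arr := rfl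

@[simp] theorem setArr_reg (a i j v : ℕ) : (s.setArr a i j v).reg = s.reg := rfl

@[simp] theorem setArr_arr (a i j v b i' j' : ℕ) :
    (s.setArr a i j v).arr b i' j' = if b = a ∧ i' = i ∧ j' = j then v else s.arr b i' j' := by
  by_cases hb : b = a <;> by_cases hi : i' = i <;> by_cases hj : j' = j <;>
    simp [setArr, hb, hi, hj]

end RState

namespace RProg

/-- The program may write to the register. -/
def writes : RProg → ℕ → Bool
  | .skip, _ => false
  | .const x _, y => x == y
  | .copy x _, y => x == y
  | .inc x, y => x == y
  | .dec x, y => x == y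
  | .load x _ _ _, y => x == y
  | .store _ _ _ _, _ => false
  | .flip x, y => x == y
  | .seq p q, y => p.writes y || q.writes y
  | .ite _ p q, y => p.writes y || q.writes y
  | .while _ p, y => p.writes y

/-- The program may write to the array. -/
def writesArr : RProg → ℕ → Bool
  | .store a _ _ _, b => a == b
  | .seq p q, b => p.writesArr b || q.writesArr b
  | .ite _ p q, b => p.writesArr b || q.writesArr b
  | .while _ p, b => p.writesArr b
  | _, _ => false

/-- Two configurations agree on everything that the program does not write to. -/
structure Frame (p : RProg) (s s' : RState) : Prop where
  reg : ∀ x, p.writes x = false → s'.reg x = s.reg x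
  arr : ∀ a, p.writesArr a = false → s'.arr a = s.arr a

theorem Frame.refl (p : RProg) (s : RState) : Frame p s s := ⟨fun _ _ => rfl, fun _ _ => rfl⟩

theorem Frame.trans {p : RProg} {s s' s'' : RState} (h : Frame p s s') (h' : Frame p s' s'') :
    Frame p s s'' :=
  ⟨fun x hx => (h'.reg x hx).trans (h.reg x hx), fun a ha => (h'.arr a ha).trans (h.arr a ha)⟩

theorem Frame.weaken {p q : RProg} {s s' : RState} (h : Frame p s s')
    (hr : ∀ x, q.writes x = false → p.writes x = false)
    (ha : ∀ a, q.writesArr a = false → p.writesArr a = false) : Frame q s s' :=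
  ⟨fun x hx => h.reg x (hr x hx), fun a h' => h.arr a (ha a h')⟩

/-- `writes` and `writesArr` are Boolean-valued, so for a concrete program and a concrete register
or array the side conditions of the frame close by `rfl`. -/
theorem frame_of_exec {ω : ℕ → Bool} {p : RProg} {s s' : RState} {t : ℕ} (h : Exec ω p s t s') :
    Frame p s s' := by
  induction h with
  | skip => exact .refl _ _
  | const | copy | inc | dec | load =>
    refine ⟨fun y hy => ?_, fun _ _ => rfl⟩
    simp only [writes, beq_eq_false_iff_ne] at hy
    simp [Ne.symm hy]
  | flip =>
    refine ⟨fun y hy => ?_, fun _ _ => rfl⟩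
    simp only [writes, beq_eq_false_iff_ne] at hy
    simp [RState.flipReg, Ne.symm hy]
  | store a y z x s =>
    refine ⟨fun _ _ => rfl, fun b hb => ?_⟩
    simp only [writesArr, beq_eq_false_iff_ne] at hb
    funext i j
    simp [Ne.symm hb]
  | seq _ _ ih ih' =>
    refine (ih.weaken ?_ ?_).trans (ih'.weaken ?_ ?_) <;> simp +contextual [writes, writesArr]
  | ite_true _ _ ih => refine ih.weaken ?_ ?_ <;> simp +contextual [writes, writesArr]
  | ite_false _ _ ih => refine ih.weaken ?_ ?_ <;> simp +contextual [writes, writesArr]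
  | while_true _ _ _ ih ih' =>
    refine (ih.weaken ?_ ?_).trans ih' <;> simp +contextual [writes, writesArr]
  | while_false => exact .refl _ _

/-- Started in `s`, the program halts after a number of steps and in a configuration that
satisfy `Q`. -/
def Wp (ω : ℕ → Bool) (p : RProg) (s : RState) (Q : ℕ → RState → Prop) : Prop :=
  ∃ t s', Exec ω p s t s' ∧ Q t s'

variable {ω : ℕ → Bool} {p q : RProg} {s : RState} {Q Q' : ℕ → RState → Prop}

/-- The frame comes for free when a specification is applied, so specifications need to record only
what changes. -/
theorem Wp.mono (h : Wp ω p s Q) (hQ : ∀ t s', Frame p s s' → Q t s' → Q' t s') :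
    Wp ω p s Q' :=
  let ⟨t, s', he, hq⟩ := h
  ⟨t, s', he, hQ t s' (frame_of_exec he) hq⟩

@[simp] theorem wp_skip : Wp ω .skip s Q ↔ Q 1 s :=
  ⟨by rintro ⟨_, _, ⟨⟩, h⟩; exact h, fun h => ⟨_, _, .skip s, h⟩⟩

@[simp] theorem wp_const {x c : ℕ} : Wp ω (.const x c) s Q ↔ Q 1 (s.setReg x c) :=
  ⟨by rintro ⟨_, _, ⟨⟩, h⟩; exact h, fun h => ⟨_, _, .const x c s, h⟩⟩

@[simp] theorem wp_copy {x y : ℕ} : Wp ω (.copy x y) s Q ↔ Q 1 (s.setReg x (s.reg y)) :=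
  ⟨by rintro ⟨_, _, ⟨⟩, h⟩; exact h, fun h => ⟨_, _, .copy x y s, h⟩⟩

@[simp] theorem wp_inc {x : ℕ} : Wp ω (.inc x) s Q ↔ Q 1 (s.setReg x (s.reg x + 1)) :=
  ⟨by rintro ⟨_, _, ⟨⟩, h⟩; exact h, fun h => ⟨_, _, .inc x s, h⟩⟩

@[simp] theorem wp_dec {x : ℕ} : Wp ω (.dec x) s Q ↔ Q 1 (s.setReg x (s.reg x - 1)) :=
  ⟨by rintro ⟨_, _, ⟨⟩, h⟩; exact h, fun h => ⟨_, _, .dec x s, h⟩⟩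

@[simp] theorem wp_load {x a y z : ℕ} :
    Wp ω (.load x a y z) s Q ↔ Q 1 (s.setReg x (s.arr a (s.reg y) (s.reg z))) :=
  ⟨by rintro ⟨_, _, ⟨⟩, h⟩; exact h, fun h => ⟨_, _, .load x a y z s, h⟩⟩

@[simp] theorem wp_store {a y z x : ℕ} :
    Wp ω (.store a y z x) s Q ↔ Q 1 (s.setArr a (s.reg y) (s.reg z) (s.reg x)) :=
  ⟨by rintro ⟨_, _, ⟨⟩, h⟩; exact h, fun h => ⟨_, _, .store a y z x s, h⟩⟩

@[simp] theorem wp_seq :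
    Wp ω (.seq p q) s Q ↔ Wp ω p s fun t s' => Wp ω q s' fun t' s'' => Q (t + t') s'' :=
  ⟨by rintro ⟨_, _, he, h⟩; cases he with | seq h₁ h₂ => exact ⟨_, _, h₁, _, _, h₂, h⟩,
    fun ⟨_, _, h₁, _, _, h₂, h⟩ => ⟨_, _, .seq h₁ h₂, h⟩⟩

theorem wp_ite {b : RTest} (ht : b.Holds s → Wp ω p s fun t s' => Q (t + 1) s')
    (hf : ¬ b.Holds s → Wp ω q s fun t s' => Q (t + 1) s') : Wp ω (.ite b p q) s Q := by
  by_cases hb : b.Holds s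
  · obtain ⟨t, s', he, hq⟩ := ht hb
    exact ⟨_, _, .ite_true hb he, hq⟩
  · obtain ⟨t, s', he, hq⟩ := hf hb
    exact ⟨_, _, .ite_false hb he, hq⟩

/-- Total correctness of a loop, with an invariant and a potential that pays for the steps. -/
theorem wp_while {b : RTest} (Inv : RState → Prop) (Φ : RState → ℕ) (h₀ : Inv s)
    (hb : ∀ s', Inv s' → b.Holds s' → Frame p s s' →
      Wp ω p s' fun t s'' => Inv s'' ∧ t + 1 + Φ s'' ≤ Φ s') :
    Wp ω (.while b p) s fun t s' => Inv s' ∧ ¬ b.Holds s' ∧ t + Φ s' ≤ Φ s + 1 := by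
  -- Strong induction on the potential, which drops in each round because it also pays for the test.
  -- The extra `1` is the final, failing test. The frame relates each round to the start of the
  -- loop.
  suffices H : ∀ N s', Φ s' = N → Inv s' → Frame p s s' → Wp ω (.while b p) s' fun t s'' =>
      Inv s'' ∧ ¬ b.Holds s'' ∧ t + Φ s'' ≤ Φ s' + 1 from H _ s rfl h₀ (.refl _ _)
  intro N
  induction N using Nat.strong_induction_on with
  | _ N ih =>
    intro s' hN hI hF
    by_cases hh : b.Holds s'
    · obtain ⟨t, s₁, he, hI₁, ht⟩ := hb s' hI hh hF
      obtain ⟨t', s₂, he', hI₂, hn, ht'⟩ :=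
        ih (Φ s₁) (by omega) s₁ rfl hI₁ (hF.trans (frame_of_exec he))
      exact ⟨_, _, .while_true hh he he', hI₂, hn, by omega⟩
    · exact ⟨1, s', .while_false hh, hI, hh, by omega⟩

/-- `for x = 0, …, y - 1 do p`. -/
def forLoop (x y : ℕ) (p : RProg) : RProg :=
  .seq (.const x 0) (.while (.lt x y) (.seq p (.inc x)))

/-- Total correctness of a counting loop: each round costs `T` and what the potential pays. -/
theorem wp_forLoop {x y N T : ℕ} (Inv : ℕ → RState → Prop) (Φ : RState → ℕ)
    (hx : p.writes x = false) (hy : (RProg.seq p (.inc x)).writes y = false)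
    (hN : s.reg y = N) (h₀ : Inv 0 (s.setReg x 0))
    (hp : ∀ i s', i < N → s'.reg x = i → s'.reg y = N → Frame (forLoop x y p) s s' → Inv i s' →
      Wp ω p s' fun t s'' => Inv (i + 1) (s''.setReg x (i + 1)) ∧
        t + Φ (s''.setReg x (i + 1)) ≤ Φ s' + T) :
    Wp ω (forLoop x y p) s fun t s' =>
      Inv N s' ∧ t + Φ s' ≤ Φ (s.setReg x 0) + N * (T + 2) + 2 := by
  have hyx : y ≠ x := by
    rintro rfl
    simp [writes] at hy
  have hy' : p.writes y = false := by
    simp only [writes, Bool.or_eq_false_iff] at hy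
    exact hy.1
  rw [forLoop, wp_seq, wp_const]
  -- Each round costs two steps beyond the body: the test and the increment.
  refine (wp_while (fun s' => ∃ i ≤ N, s'.reg x = i ∧ s'.reg y = N ∧ Inv i s')
    (fun s' => Φ s' + (N - s'.reg x) * (T + 2)) ⟨0, by simp [hN, h₀, hyx]⟩ ?_).mono ?_
  · rintro s' ⟨i, hi, hxi, hyN, hI⟩ hh hF
    simp only [RTest.Holds, hxi, hyN] at hh
    rw [wp_seq]
    have hF' : Frame (forLoop x y p) s s' := by
      refine ⟨fun z hz => ?_, fun a ha => ?_⟩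
      · simp only [forLoop, writes, Bool.or_eq_false_iff] at hz
        rw [hF.reg z (by simp [writes, hz])]
        have : z ≠ x := by
          rintro rfl
          simp at hz
        simp [this]
      · simp only [forLoop, writesArr, Bool.or_eq_false_iff] at ha
        rw [hF.arr a (by simp [writesArr, ha])]
        rfl
    refine (hp i s' hh hxi hyN hF' hI).mono ?_
    rintro t s'' hfr ⟨hI', ht⟩
    have e : s''.reg x = i := by rw [hfr.reg x hx, hxi]
    rw [wp_inc]
    have e' : s''.reg y = N := by rw [hfr.reg y hy', hyN]
    rw [e]
    refine ⟨⟨i + 1, hh, by simp, by simp [hyx, e'], hI'⟩, ?_⟩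
    obtain ⟨d, rfl⟩ : ∃ d, N = i + 1 + d := ⟨N - (i + 1), by omega⟩
    have h1 : i + 1 + d - i = d + 1 := by omega
    simp only [RState.setReg_reg, if_true, hxi, h1]
    have h2 : i + 1 + d - (i + 1) = d := by omega
    rw [h2, Nat.add_mul]
    omega
  · rintro t s' - ⟨⟨i, hi, hxi, hyN, hI⟩, hh, ht⟩
    simp only [RTest.Holds, hxi, hyN, not_lt] at hh
    obtain rfl : i = N := le_antisymm hi hh
    refine ⟨hI, ?_⟩
    simp [hxi] at ht
    omega

end RProg

/-! ### Packings and spanning trees -/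

/-- Disjoint balls in a metric on the nodes of a rooted tree, all but one of the radii are paid for
by the weight of the tree. -/
theorem sum_radius_le_sum_parent {V : Type*} [DecidableEq V] {d : V → V → ℕ}
    (hd : ∀ a b c, d a c ≤ d a b + d b c) (hc : ∀ a b, d a b = d b a) {root : V}
    {depth : V → ℕ} {par : V → V}
    (hpar : ∀ v, v ≠ root → depth (par v) < depth v) {R : ℕ} (U : Finset V) (hroot : root ∈ U)
    (hU : ∀ v ∈ U, v ≠ root → par v ∈ U) (r : V → ℕ) (hR : ∀ v, r v ≤ R)
    (hr : ∀ u v, u ≠ v → r u ≠ 0 → r v ≠ 0 → r u + r v ≤ d u v) :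
    ∑ v ∈ U, r v ≤ ∑ v ∈ U.erase root, d v (par v) + R := by
  induction hm : U.card generalizing U r with
  | zero => simp [Finset.card_eq_zero.mp hm] at hroot
  | succ m ih =>
    rcases (U.erase root).eq_empty_or_nonempty with h0 | hne
    · obtain rfl : U = {root} := by
        rw [← Finset.insert_erase hroot, h0]
        rfl
      simpa using hR root
    · obtain ⟨v, hv, hmax⟩ := (U.erase root).exists_max_image depth hne
      obtain ⟨hvr, hvU⟩ := Finset.mem_erase.mp hv
      have hpv : par v ≠ v := fun h => by simpa [h] using hpar v hvr
      set p := par v with hp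
      set e := r v - d v p with he
      -- A ball reaching beyond the parent excludes a ball around the parent. The surplus is then
      -- the whole new radius there, and `R` still bounds it.
      have hzero : e ≠ 0 → r p = 0 := by
        intro h
        by_contra h'
        have := hr v p hpv.symm (by omega) h'
        omega
      set r' : V → ℕ := fun x => if x = v then 0 else if x = p then r x + e else r x with hr'
      -- Moving the center from `v` to `p` brings other points closer by at most `d v p`, which is
      -- what the radius has lost.
      have key : ∀ x, x ≠ v → x ≠ p → r x ≠ 0 → r p + e ≠ 0 → r p + e + r x ≤ d p x := by
        intro x hxv hxp hx hpe
        by_cases h : e = 0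
        · rw [h] at hpe ⊢
          exact hr p x (Ne.symm hxp) (by simpa using hpe) hx
        · have h1 := hr v x (Ne.symm hxv) (by omega) hx
          have h2 := hd v p x
          have h3 := hzero h
          omega
      have hpU : p ∈ U.erase v := Finset.mem_erase.mpr ⟨hpv, hU v hvU hvr⟩
      have hlt : ∀ u ∈ U.erase v, u ≠ root → par u ∈ U.erase v := by
        intro u hu hur
        obtain ⟨huv, huU⟩ := Finset.mem_erase.mp hu
        refine Finset.mem_erase.mpr ⟨fun h => ?_, hU u huU hur⟩
        have h1 := hpar u hur
        have h2 := hmax u (Finset.mem_erase.mpr ⟨hur, huU⟩)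
        rw [h] at h1
        omega
      have h1 := ih (U.erase v) (Finset.mem_erase.mpr ⟨hvr.symm, hroot⟩) hlt r' ?_ ?_
        (by rw [Finset.card_erase_of_mem hvU, hm]; rfl)
      · have h2 : ∑ x ∈ U.erase v, r' x = ∑ x ∈ U.erase v, r x + e := by
          rw [← Finset.add_sum_erase _ _ hpU, ← Finset.add_sum_erase _ r hpU]
          have : ∑ x ∈ (U.erase v).erase p, r' x = ∑ x ∈ (U.erase v).erase p, r x := by
            refine Finset.sum_congr rfl fun x hx => ?_
            simp only [Finset.mem_erase] at hx
            simp [hr', hx.1, hx.2.1]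
          rw [this]
          simp only [hr', if_neg hpv, if_true]
          omega
        have h3 := Finset.add_sum_erase _ r hvU
        have h4 := Finset.add_sum_erase _ (fun u => d u (par u)) hv
        rw [Finset.erase_right_comm] at h4
        simp only [← hp] at h4
        omega
      · intro x
        simp only [hr']
        split_ifs with hxv hxp
        · omega
        · by_cases h : e = 0
          · simpa [h] using hR x
          · have := hR v
            rw [hxp, hzero h]
            omega
        · exact hR x
      · intro x y hxy hx hy
        have hxv : x ≠ v := fun h => hx (by simp [hr', h])
        have hyv : y ≠ v := fun h => hy (by simp [hr', h])
        simp only [hr', if_neg hxv, if_neg hyv] at hx hy ⊢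
        by_cases hxp : x = p
        · have hyp : y ≠ p := fun h => hxy (hxp.trans h.symm)
          rw [if_pos hxp] at hx ⊢
          rw [if_neg hyp] at hy ⊢
          rw [hxp] at hx ⊢
          exact key y hyv hyp hy hx
        · rw [if_neg hxp] at hx ⊢
          by_cases hyp : y = p
          · rw [if_pos hyp] at hy ⊢
            rw [hyp] at hy ⊢
            rw [hc, add_comm]
            exact key x hxv hxp hx hy
          · rw [if_neg hyp] at hy ⊢
            exact hr x y hxy hx hy

namespace BoolMat

variable {n : ℕ}

/-- A `D`-separated set of more than `D` rows forces a heavy spanning tree. -/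
theorem le_MWT_of_separated (B : BoolMat n) (Z : Finset (Fin n)) {D : ℕ} (hZ : Z.card = D + 1)
    (hsep : ∀ u ∈ Z, ∀ v ∈ Z, u ≠ v → D < hammingDist (B u) (B v)) :
    D * ((D + 1) / 2) ≤ B.MWT := by
  classical
  obtain ⟨root, -⟩ : Z.Nonempty := Finset.card_pos.mp (by omega)
  have : Nonempty (Fin n) := ⟨root⟩
  have hne : {w | ∃ T : SimpleGraph (Fin n), T.IsTree ∧
      w = ∑ e ∈ T.edgeFinset, rowWeight B e}.Nonempty := by
    obtain ⟨T, -, hT⟩ := (SimpleGraph.connected_top (V := Fin n)).exists_isTree_le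
    exact ⟨_, T, hT, rfl⟩
  obtain ⟨T, hT, hw⟩ := Nat.sInf_mem hne
  have hM : B.MWT = ∑ e ∈ T.edgeFinset, rowWeight B e := by
    rw [MWT]
    convert hw
  -- The parent is the next vertex on a shortest path to the root.
  have hex : ∀ v, ∃ p, v ≠ root → T.Adj v p ∧ T.dist root p < T.dist root v := by
    intro v
    by_cases hv : v = root
    · exact ⟨v, fun h => absurd hv h⟩
    · obtain ⟨w, hw⟩ := hT.connected.exists_walk_length_eq_dist v root
      cases w with
      | nil => exact absurd rfl hv
      | cons hadj w' =>
        refine ⟨_, fun _ => ⟨hadj, ?_⟩⟩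
        have := SimpleGraph.dist_le w'
        rw [SimpleGraph.Walk.length_cons] at hw
        rw [SimpleGraph.dist_comm, SimpleGraph.dist_comm (u := root) (v := v)]
        omega
  choose par hpar using hex
  -- The largest radius with `R + R ≤ D + 1`, a lower bound for the distances within `Z`.
  set R := (D + 1) / 2
  have h1 := sum_radius_le_sum_parent (d := fun u v => hammingDist (B u) (B v))
    (fun a b c => hammingDist_triangle _ _ _) (fun a b => hammingDist_comm _ _)
    (fun v hv => (hpar v hv).2) (R := R) Finset.univ (Finset.mem_univ _)
    (fun _ _ _ => Finset.mem_univ _) (fun v => if v ∈ Z then R else 0)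
    (fun v => by split_ifs <;> omega) ?_
  · have h2 : ∑ v ∈ Finset.univ.erase root, hammingDist (B v) (B (par v)) ≤ B.MWT := by
      rw [hM]
      -- Parent edges are distinct: two vertices cannot be each other's parents, as a parent is
      -- closer to the root.
      have h3 : ∑ e ∈ (Finset.univ.erase root).image (fun v => s(v, par v)), rowWeight B e =
          ∑ v ∈ Finset.univ.erase root, hammingDist (B v) (B (par v)) := by
        rw [Finset.sum_image]
        · rfl
        intro u hu v hv huv
        have hu' := (hpar u (by simpa using hu)).2
        have hv' := (hpar v (by simpa using hv)).2
        rcases Sym2.eq_iff.mp huv with ⟨h, -⟩ | ⟨h, h'⟩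
        · exact h
        · rw [h'] at hu'
          rw [← h] at hv'
          omega
      · rw [← h3]
        refine Finset.sum_le_sum_of_subset fun e he => ?_
        obtain ⟨v, hv, rfl⟩ := Finset.mem_image.mp he
        simpa using (hpar v (Finset.mem_erase.mp hv).1).1
    -- This gives `(D + 1) * R ≤ MWT + R`, and the one unpaid radius cancels.
    rw [Finset.sum_ite_mem, Finset.univ_inter, Finset.sum_const, hZ, smul_eq_mul,
      Nat.succ_mul] at h1
    omega
  · intro u v huv hu hv
    simp only [ne_eq, ite_eq_right_iff, Classical.not_imp] at hu hv
    have := hsep u hu.1 v hv.1 huv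
    simp only [hu.1, hv.1, if_true]
    omega

/-! ### Powers and paths -/

theorem exists_pow_iff (B : BoolMat n) (i j : Fin n) :
    (∃ k, pow B k i j = true) ↔ Relation.ReflTransGen (fun u v => B u v = true) i j := by
  constructor
  · rintro ⟨k, hk⟩
    induction k generalizing j with
    | zero =>
      obtain rfl : i = j := by simpa [pow, one] using hk
      exact .refl
    | succ k ih =>
      obtain ⟨l, hl, hlj⟩ : ∃ l, pow B k i l = true ∧ B l j = true := by
        simpa [pow, mul] using hk
      exact (ih l hl).tail hlj
  · intro h
    induction h with
    | refl => exact ⟨0, by simp [pow, one]⟩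
    | tail _ hlj ih =>
      obtain ⟨k, hk⟩ := ih
      exact ⟨k + 1, by simpa [pow, mul] using ⟨_, hk, hlj⟩⟩

open Classical in
theorem reflTransClosure_apply (B : BoolMat n) (i j : Fin n) : B.reflTransClosure i j =
    decide (Relation.ReflTransGen (fun u v => B u v = true) i j) := by
  simp [reflTransClosure, exists_pow_iff]

open Classical in
theorem transClosure_apply (B : BoolMat n) (i j : Fin n) : B.transClosure i j =
    decide (Relation.TransGen (fun u v => B u v = true) i j) := by
  simp only [transClosure, Matrix.of_apply]
  congr 1
  rw [Relation.TransGen.tail'_iff, eq_iff_iff]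
  constructor
  · rintro ⟨_ | k, hk, h⟩
    · omega
    · obtain ⟨l, hl, hlj⟩ : ∃ l, pow B k i l = true ∧ B l j = true := by
        simpa [pow, mul] using h
      exact ⟨l, (exists_pow_iff B i l).mp ⟨k, hl⟩, hlj⟩
  · rintro ⟨l, hl, hlj⟩
    obtain ⟨k, hk⟩ := (exists_pow_iff B i l).mpr hl
    exact ⟨k + 1, by omega, by simpa [pow, mul] using ⟨_, hk, hlj⟩⟩

end BoolMat

/-! ### Closures of digraphs as closures of their adjacency matrices -/

namespace Digraph

variable {n : ℕ} (G : Digraph (Fin n))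

theorem boolAdj_eq_true : (fun u v => G.boolAdj u v = true) = G.Adj := by
  funext u v
  simp [boolAdj]

theorem boolAdj_transClosure : G.transClosure.boolAdj = G.boolAdj.transClosure := by
  ext i j
  rw [BoolMat.transClosure_apply, boolAdj_eq_true]
  rfl

theorem boolAdj_reflTransClosure : G.reflTransClosure.boolAdj = G.boolAdj.reflTransClosure := by
  ext i j
  rw [BoolMat.reflTransClosure_apply, boolAdj_eq_true]
  rfl

end Digraph

/-! ### Clustering the rows

The programs below use register `0` for `n`, `1` for the threshold `D`, `2` for zero, `3` for one,
`4` for the success flag and `5` for the number of clusters. Array `0` holds the input, `1` the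
output, `2` lists for each row the columns in which it differs from the center of its cluster, `3`
holds these centers, `4` the lengths of the lists. -/

/-- A matrix or its transpose. -/
def view (tr : Bool) (A : ℕ → ℕ → ℕ) (i j : ℕ) : ℕ := A (bif tr then j else i) (bif tr then i else j)

/-- The Hamming distance of two rows. -/
def rowDist (n : ℕ) (A : ℕ → ℕ → ℕ) (i j : ℕ) : ℕ :=
  ((Finset.range n).filter fun k => A i k ≠ A j k).card

/-- A list of columns covers all columns in which the rows `i` and `r` differ. -/
structure DiffList (n : ℕ) (A : ℕ → ℕ → ℕ) (i r len : ℕ) (l : ℕ → ℕ) : Prop where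
  cover : ∀ k < n, A i k ≠ A r k → ∃ p < len, l p = k

/-! ### Listing the differences of two rows -/

namespace RProg

/-- Register `x` receives the entry of the (transposed) input matrix. -/
def loadIn (tr : Bool) (x i j : ℕ) : RProg :=
  .load x 0 (bif tr then j else i) (bif tr then i else j)

variable {ω : ℕ → Bool} {s : RState} {Q : ℕ → RState → Prop}

@[simp] theorem wp_loadIn {tr : Bool} {x i j : ℕ} : Wp ω (loadIn tr x i j) s Q ↔
    Q 1 (s.setReg x (view tr (s.arr 0) (s.reg i) (s.reg j))) := by
  cases tr <;> simp [loadIn, view]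

/-- List the columns in which the rows in registers `7` and `6` differ. -/
def compareRows (tr : Bool) : RProg :=
  .seq (.const 11 0) (forLoop 8 0
    (.seq (loadIn tr 9 7 8) (.seq (loadIn tr 10 6 8)
      (.ite (.eq 9 10) .skip (.seq (.store 2 7 11 8) (.inc 11))))))

/-- The list has exactly as many entries as the rows have differences, so one comparison of register
`11` with the threshold bounds both the distance and the length of the list. -/
theorem wp_compareRows {tr : Bool} {n i r : ℕ} {A : ℕ → ℕ → ℕ} (h0 : s.reg 0 = n)
    (h7 : s.reg 7 = i) (h6 : s.reg 6 = r) (hA : view tr (s.arr 0) = A) :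
    Wp ω (compareRows tr) s fun t s' => t ≤ n * 7 + 3 ∧ s'.reg 11 = rowDist n A i r ∧
      DiffList n A i r (s'.reg 11) (s'.arr 2 i) ∧ ∀ j, j ≠ i → s'.arr 2 j = s.arr 2 j := by
  rw [compareRows, wp_seq, wp_const]
  refine (wp_forLoop (N := n) (T := 5) (fun k s' => s'.reg 11 = rowDist k A i r ∧
      (∀ k' < k, A i k' ≠ A r k' → ∃ p < s'.reg 11, s'.arr 2 i p = k') ∧
      ∀ j, j ≠ i → s'.arr 2 j = s.arr 2 j) (fun _ => 0) rfl rfl (by simp [h0]) ?_ ?_).mono ?_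
  · simp [rowDist]
  · rintro k s' hk h8 h0' hF ⟨h11, hcov, hfr⟩
    have h7' : s'.reg 7 = i := by rw [hF.reg 7 rfl]; simp [h7]
    have h6' : s'.reg 6 = r := by rw [hF.reg 6 rfl]; simp [h6]
    have hA' : view tr (s'.arr 0) = A := by rw [hF.arr 0 rfl]; simp [hA]
    simp only [wp_seq, wp_loadIn]
    refine wp_ite ?_ ?_
    · intro hh
      simp [RTest.Holds, h7', h6', h8, hA'] at hh
      simp only [wp_skip]
      refine ⟨⟨?_, ?_, ?_⟩, by omega⟩
      · simp [h11, rowDist, Finset.range_add_one, Finset.filter_insert, hh]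
      · intro k' hk' hne
        rcases Nat.lt_succ_iff_lt_or_eq.mp hk' with h | rfl
        · simpa using hcov k' h hne
        · exact absurd hh hne
      · simpa using hfr
    · intro hh
      simp [RTest.Holds, h7', h6', h8, hA'] at hh
      simp only [wp_seq, wp_store, wp_inc]
      refine ⟨⟨?_, ?_, ?_⟩, by omega⟩
      · simp [h11, rowDist, Finset.range_add_one, Finset.filter_insert, hh]
      · intro k' hk' hne
        simp [h7', h8]
        rcases Nat.lt_succ_iff_lt_or_eq.mp hk' with h | rfl
        · obtain ⟨p, hp, hpk⟩ := hcov k' h hne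
          exact ⟨p, by omega, by rw [if_neg (by omega), hpk]⟩
        · exact ⟨s'.reg 11, by omega, by simp⟩
      · intro j hj
        funext p
        simp [h7', hj, hfr j hj]
  · rintro t s' hF ⟨⟨h11, hcov, hfr⟩, ht⟩
    exact ⟨by omega, h11, ⟨hcov⟩, hfr⟩

end RProg

/-- In the arrays `a`, row `i` is assigned to the cluster of some center in `Z`. -/
structure Assigned (n D : ℕ) (A : ℕ → ℕ → ℕ) (Z : Finset ℕ) (a : ℕ → ℕ → ℕ → ℕ) (i : ℕ) :
    Prop where
  mem : a 3 i 0 ∈ Z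
  len_le : a 4 i 0 ≤ D
  dist_le : rowDist n A i (a 3 i 0) ≤ D
  diff : DiffList n A i (a 3 i 0) (a 4 i 0) (a 2 i)

/-- Row `i` is assigned to a cluster, or marked as unassigned and far from all centers. -/
def Settled (n D : ℕ) (A : ℕ → ℕ → ℕ) (Z : Finset ℕ) (a : ℕ → ℕ → ℕ → ℕ) (i : ℕ) : Prop :=
  (a 3 i 0 = n ∧ ∀ z ∈ Z, D < rowDist n A i z) ∨ Assigned n D A Z a i

theorem Settled.congr {n D : ℕ} {A : ℕ → ℕ → ℕ} {Z : Finset ℕ} {a b : ℕ → ℕ → ℕ → ℕ} {i : ℕ}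
    (h : Settled n D A Z a i) (h2 : b 2 i = a 2 i) (h3 : b 3 i = a 3 i) (h4 : b 4 i = a 4 i) :
    Settled n D A Z b i := by
  refine h.imp (fun ⟨h, h'⟩ => ⟨by rw [h3, h], h'⟩) fun h => ⟨?_, ?_, ?_, ?_⟩
  · rw [h3]; exact h.mem
  · rw [h4]; exact h.len_le
  · rw [h3]; exact h.dist_le
  · rw [h2, h3, h4]; exact h.diff

theorem Assigned.mono {n D : ℕ} {A : ℕ → ℕ → ℕ} {Z Z' : Finset ℕ} {a : ℕ → ℕ → ℕ → ℕ} {i : ℕ}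
    (h : Assigned n D A Z a i) (hZ : Z ⊆ Z') : Assigned n D A Z' a i :=
  ⟨hZ h.mem, h.len_le, h.dist_le, h.diff⟩

/-- The rows in `Z` have pairwise distances above `D`. -/
def Separated (n D : ℕ) (A : ℕ → ℕ → ℕ) (Z : Finset ℕ) : Prop :=
  ∀ u ∈ Z, ∀ v ∈ Z, u ≠ v → D < rowDist n A u v

theorem rowDist_comm (n : ℕ) (A : ℕ → ℕ → ℕ) (i j : ℕ) : rowDist n A i j = rowDist n A j i := by
  simp only [rowDist, ne_comm]

theorem Separated.insert {n D : ℕ} {A : ℕ → ℕ → ℕ} {Z : Finset ℕ} (h : Separated n D A Z) {r : ℕ}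
    (hr : ∀ z ∈ Z, D < rowDist n A r z) : Separated n D A (insert r Z) := by
  intro u hu v hv huv
  rcases Finset.mem_insert.mp hu with rfl | hu' <;> rcases Finset.mem_insert.mp hv with rfl | hv'
  · exact absurd rfl huv
  · exact hr v hv'
  · rw [rowDist_comm]
    exact hr u hu'
  · exact h u hu' v hv' huv

/-! ### Greedy clustering -/

namespace RProg

variable {ω : ℕ → Bool} {s : RState}

/-- Assign the row in register `7`, if it is unassigned and close enough, to the cluster of the row
in register `6`. -/
def assignRow (tr : Bool) : RProg :=
  .seq (.load 9 3 7 2) (.ite (.eq 9 0)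
    (.seq (compareRows tr) (.ite (.lt 1 11) .skip (.seq (.store 4 7 2 11) (.store 3 7 2 6))))
    .skip)

/-- The marker `n` for an unassigned row cannot be confused with a center. A list left behind by a
comparison with a center that is too far is harmless, since nothing is required of the list of an
unassigned row. -/
theorem wp_assignRow {tr : Bool} {n D i r : ℕ} {A : ℕ → ℕ → ℕ} {Z : Finset ℕ} (h0 : s.reg 0 = n)
    (h1 : s.reg 1 = D) (h2 : s.reg 2 = 0) (h7 : s.reg 7 = i) (h6 : s.reg 6 = r)
    (hA : view tr (s.arr 0) = A) (hZ : ∀ z ∈ Z, z < n) (hs : Settled n D A Z s.arr i) :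
    Wp ω (assignRow tr) s fun t s' => t ≤ n * 7 + 8 ∧ Settled n D A (insert r Z) s'.arr i ∧
      ∀ j, j ≠ i → s'.arr 2 j = s.arr 2 j ∧ s'.arr 3 j = s.arr 3 j ∧ s'.arr 4 j = s.arr 4 j := by
  simp only [assignRow, wp_seq, wp_load]
  refine wp_ite ?_ ?_
  · intro hh
    simp only [RTest.Holds, RState.setReg_reg, h7, h2, h0] at hh
    simp at hh
    have hfar : ∀ z ∈ Z, D < rowDist n A i z := by
      rcases hs with hs | hs
      · exact hs.2
      · have := hZ _ hs.mem
        omega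
    rw [wp_seq]
    refine (wp_compareRows (n := n) (i := i) (r := r) (A := A) (by simp [h0]) (by simp [h7])
      (by simp [h6]) (by simp [hA])).mono ?_
    rintro t s' hF ⟨ht, h11, hl, hfr⟩
    have g1 : s'.reg 1 = D := by rw [hF.reg 1 rfl]; simp [h1]
    have g2 : s'.reg 2 = 0 := by rw [hF.reg 2 rfl]; simp [h2]
    have g7 : s'.reg 7 = i := by rw [hF.reg 7 rfl]; simp [h7]
    have g6 : s'.reg 6 = r := by rw [hF.reg 6 rfl]; simp [h6]
    have a3 : s'.arr 3 = s.arr 3 := hF.arr 3 rfl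
    have a4 : s'.arr 4 = s.arr 4 := hF.arr 4 rfl
    refine wp_ite ?_ ?_
    · intro hlt
      simp only [RTest.Holds, g1] at hlt
      rw [wp_skip]
      refine ⟨by omega, .inl ⟨by rw [a3, hh], ?_⟩, fun j hj => ⟨hfr j hj, by rw [a3], by rw [a4]⟩⟩
      intro z hz
      rcases Finset.mem_insert.mp hz with rfl | hz
      · omega
      · exact hfar z hz
    · intro hlt
      simp only [RTest.Holds, g1] at hlt
      simp only [wp_seq, wp_store, g2, g7, g6, RState.setArr_reg]
      refine ⟨by omega, .inr ⟨?_, ?_, ?_, ?_⟩, fun j hj => ⟨?_, ?_, ?_⟩⟩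
      · simp
      · simp; omega
      · simp; omega
      · have e : ((s'.setArr 4 i 0 (s'.reg 11)).setArr 3 i 0 r).arr 2 i = s'.arr 2 i := by
          funext p
          simp
        rw [e]
        simpa using hl
      · funext p
        simpa using congrFun (hfr j hj) p
      · funext p
        simp [hj, a3]
      · funext p
        simp [hj, a4]
  · intro hh
    simp only [RTest.Holds, RState.setReg_reg, h7, h2, h0] at hh
    simp at hh
    rw [wp_skip]
    refine ⟨by omega, .inr ?_, fun j _ => ⟨rfl, rfl, rfl⟩⟩
    exact (hs.resolve_left fun h => hh h.1).mono (Finset.subset_insert _ _)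

/-- Form a cluster around the row in register `6`. -/
def addCluster (tr : Bool) : RProg := forLoop 7 0 (assignRow tr)

/-- Rows already passed are settled for `insert r Z`, the others still for `Z`. The last clause
protects row `n` of arrays `2` and `4`, where the search expects the list of all columns. -/
theorem wp_addCluster {tr : Bool} {n D r : ℕ} {A : ℕ → ℕ → ℕ} {Z : Finset ℕ} (h0 : s.reg 0 = n)
    (h1 : s.reg 1 = D) (h2 : s.reg 2 = 0) (h6 : s.reg 6 = r)
    (hA : view tr (s.arr 0) = A) (hZ : ∀ z ∈ Z, z < n) (hs : ∀ i < n, Settled n D A Z s.arr i) :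
    Wp ω (addCluster tr) s fun t s' => t ≤ n * (n * 7 + 10) + 2 ∧
      (∀ i < n, Settled n D A (insert r Z) s'.arr i) ∧
      ∀ j, n ≤ j → s'.arr 2 j = s.arr 2 j ∧ s'.arr 4 j = s.arr 4 j := by
  refine (wp_forLoop (N := n) (T := n * 7 + 8) (fun i s' =>
    (∀ j < i, Settled n D A (insert r Z) s'.arr j) ∧
    (∀ j < n, i ≤ j → Settled n D A Z s'.arr j) ∧
    ∀ j, n ≤ j → s'.arr 2 j = s.arr 2 j ∧ s'.arr 4 j = s.arr 4 j) (fun _ => 0) rfl rfl h0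
    ?_ ?_).mono ?_
  · simpa using hs
  · rintro i s' hi h7 h0' hF ⟨hl, hr, hfr⟩
    refine (wp_assignRow (D := D) (r := r) (A := A) (Z := Z) h0' (by rw [hF.reg 1 rfl, h1])
      (by rw [hF.reg 2 rfl, h2]) h7 (by rw [hF.reg 6 rfl, h6]) (by rw [hF.arr 0 rfl, hA]) hZ
      (hr i hi le_rfl)).mono ?_
    rintro t s'' - ⟨ht, hs'', hfr'⟩
    refine ⟨⟨fun j hj => ?_, fun j hj hij => ?_, fun j hj => ?_⟩, by omega⟩
    · rcases Nat.lt_succ_iff_lt_or_eq.mp hj with h | rfl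
      · obtain ⟨e2, e3, e4⟩ := hfr' j (by omega)
        exact (hl j h).congr e2 e3 e4
      · exact hs''
    · obtain ⟨e2, e3, e4⟩ := hfr' j (by omega)
      exact (hr j hj (by omega)).congr e2 e3 e4
    · obtain ⟨e2, e3, e4⟩ := hfr' j (by omega)
      exact ⟨e2.trans (hfr j hj).1, e4.trans (hfr j hj).2⟩
  · rintro t s' - ⟨⟨hl, -, hfr⟩, ht⟩
    rw [show n * 7 + 8 + 2 = n * 7 + 10 from rfl] at ht
    exact ⟨by omega, hl, hfr⟩

/-- Greedy clustering of the rows of the (transposed) input matrix with radius and number of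
clusters bounded by register `1`; register `4` tells whether it succeeded. -/
def cluster (tr : Bool) : RProg :=
  .seq (forLoop 7 0 (.store 3 7 2 0)) (.seq (.const 4 1) (.seq (.const 5 0)
    (forLoop 6 0 (.seq (.load 9 3 6 2) (.ite (.eq 9 0)
      (.ite (.lt 5 1) (.seq (.inc 5) (addCluster tr)) (.const 4 0)) .skip)))))

/-- All rows belong to clusters around at most `D` centers. -/
def Clustering (n D : ℕ) (A : ℕ → ℕ → ℕ) (a : ℕ → ℕ → ℕ → ℕ) : Prop :=
  ∃ Z : Finset ℕ, (∀ z ∈ Z, z < n) ∧ Z.card ≤ D ∧ ∀ i < n, Assigned n D A Z a i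

/-- There are more than `D` rows at pairwise distances above `D`. -/
def Scattered (n D : ℕ) (A : ℕ → ℕ → ℕ) : Prop :=
  ∃ Z : Finset ℕ, (∀ z ∈ Z, z < n) ∧ Z.card = D + 1 ∧ Separated n D A Z

theorem wp_cluster {tr : Bool} {n D : ℕ} {A : ℕ → ℕ → ℕ} (h0 : s.reg 0 = n)
    (h1 : s.reg 1 = D) (h2 : s.reg 2 = 0) (hA : view tr (s.arr 0) = A) :
    Wp ω (cluster tr) s fun t s' => t ≤ D * (n * (n * 7 + 10) + 2) + 11 * n + 6 ∧
      (∀ j, n ≤ j → s'.arr 2 j = s.arr 2 j ∧ s'.arr 4 j = s.arr 4 j) ∧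
      (s'.reg 4 = 1 ∧ Clustering n D A s'.arr ∨ s'.reg 4 = 0 ∧ Scattered n D A) := by
  rw [cluster, wp_seq]
  refine (wp_forLoop (N := n) (T := 1) (fun i s' => ∀ j < i, s'.arr 3 j 0 = n)
    (fun _ => 0) rfl rfl h0 (by simp) ?_).mono ?_
  · rintro i s' hi h7 h0' hF hl
    simp only [wp_store]
    refine ⟨fun j hj => ?_, by omega⟩
    have : s'.reg 2 = 0 := by rw [hF.reg 2 rfl, h2]
    simp only [RState.setReg_arr, RState.setArr_arr, h7, this, h0']
    split_ifs with h
    · rfl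
    · exact hl j (by simp at h; omega)
  rintro t₁ s₁ hF₁ ⟨hl, ht₁⟩
  simp only [wp_seq, wp_const]
  set W := n * (n * 7 + 10) + 2 with hW
  -- Only a round that opens a cluster is expensive; the potential holds `W` for each cluster that
  -- may still be opened.
  refine (wp_forLoop (N := n) (T := 5) (fun r s' =>
    (∀ j, n ≤ j → s'.arr 2 j = s₁.arr 2 j ∧ s'.arr 4 j = s₁.arr 4 j) ∧
    ∃ Z : Finset ℕ, (∀ z ∈ Z, z < r) ∧ Z.card = s'.reg 5 ∧ s'.reg 5 ≤ D ∧
      Separated n D A Z ∧ (∀ i < n, Settled n D A Z s'.arr i) ∧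
      (s'.reg 4 = 1 ∧ (∀ i < r, ∃ z ∈ Z, rowDist n A i z ≤ D) ∨
        s'.reg 4 = 0 ∧ Scattered n D A)) (fun s' => (D - s'.reg 5) * W) rfl rfl
    (by simp [hF₁.reg 0 rfl, h0]) ?_ ?_).mono ?_
  · refine ⟨by simp, ∅, by simp, by simp, by simp, by simp [Separated], fun i hi => ?_, by simp⟩
    exact .inl ⟨by simpa using hl i hi, by simp⟩
  · rintro r s' hr h6 h0' hF ⟨hfr, Z, hZr, hcard, hD, hsep, hset, hok⟩
    have g1 : s'.reg 1 = D := by rw [hF.reg 1 rfl]; simp [hF₁.reg 1 rfl, h1]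
    have g2 : s'.reg 2 = 0 := by rw [hF.reg 2 rfl]; simp [hF₁.reg 2 rfl, h2]
    have gA : view tr (s'.arr 0) = A := by rw [hF.arr 0 rfl]; simp [hF₁.arr 0 rfl, hA]
    have hZn : ∀ z ∈ Z, z < n := fun z hz => (hZr z hz).trans hr
    simp only [wp_seq, wp_load]
    refine wp_ite ?_ ?_
    · intro hh
      simp only [RTest.Holds, RState.setReg_reg, h6, g2, h0'] at hh
      simp at hh
      have hfar : ∀ z ∈ Z, D < rowDist n A r z := by
        rcases hset r hr with hs | hs
        · exact hs.2
        · have := hZn _ hs.mem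
          omega
      have hrZ : r ∉ Z := fun h => lt_irrefl _ (hZr r h)
      have hins : ∀ z ∈ insert r Z, z < r + 1 := by
        intro z hz
        rcases Finset.mem_insert.mp hz with rfl | hz
        · omega
        · exact (hZr z hz).trans (by omega)
      refine wp_ite ?_ ?_
      · intro hlt
        simp only [RTest.Holds, RState.setReg_reg, g1] at hlt
        simp at hlt
        simp only [wp_seq, wp_inc]
        refine (wp_addCluster (n := n) (D := D) (r := r) (A := A) (Z := Z) (by simp [h0'])
          (by simp [g1]) (by simp [g2]) (by simp [h6]) (by simp [gA]) hZn
          (by simpa using hset)).mono ?_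
        rintro t s'' hF' ⟨ht, hset', hfr'⟩
        have e5 : s''.reg 5 = s'.reg 5 + 1 := by rw [hF'.reg 5 rfl]; simp
        have e4 : s''.reg 4 = s'.reg 4 := by rw [hF'.reg 4 rfl]; simp
        refine ⟨⟨fun j hj => ?_, insert r Z, hins, ?_, ?_, hsep.insert hfar, by simpa using hset',
          ?_⟩, ?_⟩
        · obtain ⟨e2, e4⟩ := hfr' j hj
          exact ⟨e2.trans (hfr j hj).1, e4.trans (hfr j hj).2⟩
        · simp [Finset.card_insert_of_notMem hrZ, e5, hcard]
        · simp [e5]; omega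
        · refine hok.imp (fun ⟨h4, hc⟩ => ⟨by simp [e4, h4], fun i hi => ?_⟩)
            (fun ⟨h4, hc⟩ => ⟨by simp [e4, h4], hc⟩)
          rcases Nat.lt_succ_iff_lt_or_eq.mp hi with h | rfl
          · obtain ⟨z, hz, hzD⟩ := hc i h
            exact ⟨z, Finset.mem_insert_of_mem hz, hzD⟩
          · exact ⟨i, Finset.mem_insert_self _ _, by simp [rowDist]⟩
        · obtain ⟨e, he⟩ : ∃ e, D = s'.reg 5 + 1 + e := ⟨D - (s'.reg 5 + 1), by omega⟩
          have q1 : D - s'.reg 5 = e + 1 := by omega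
          have q2 : D - (s'.reg 5 + 1) = e := by omega
          simp only [RState.setReg_reg, e5]
          simp only [show (5 : ℕ) ≠ 6 from by decide, if_false, q1, q2, Nat.add_mul]
          omega
      · intro hlt
        simp only [RTest.Holds, RState.setReg_reg, g1] at hlt
        simp at hlt
        rw [wp_const]
        -- The row `r` would be center number `D + 1`. It witnesses the failure together with `Z`,
        -- but is not added to the centers.
        refine ⟨⟨by simpa using hfr, Z, fun z hz => (hZr z hz).trans (by omega), by simpa using hcard,
          by simpa using hD, hsep, by simpa using hset, .inr ⟨by simp, insert r Z,
          fun z hz => by have := hins z hz; omega, ?_, hsep.insert hfar⟩⟩, ?_⟩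
        · rw [Finset.card_insert_of_notMem hrZ]
          omega
        · simp
          omega
    · intro hh
      simp only [RTest.Holds, RState.setReg_reg, h6, g2, h0'] at hh
      simp at hh
      rw [wp_skip]
      refine ⟨⟨by simpa using hfr, Z, fun z hz => (hZr z hz).trans (by omega), by simpa using hcard,
          by simpa using hD, hsep, by simpa using hset, ?_⟩, by simp; omega⟩
      refine hok.imp (fun ⟨h4, hc⟩ => ⟨by simp [h4], fun i hi => ?_⟩)
        (fun ⟨h4, hc⟩ => ⟨by simp [h4], hc⟩)
      rcases Nat.lt_succ_iff_lt_or_eq.mp hi with h | rfl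
      · exact hc i h
      · have := (hset i hr).resolve_left fun h => hh h.1
        exact ⟨_, this.mem, this.dist_le⟩
  · rintro t s' hF ⟨⟨hfr, Z, hZr, hcard, hD, hsep, hset, hok⟩, ht⟩
    refine ⟨?_, fun j hj => ?_, ?_⟩
    · simp at ht
      omega
    · rw [(hfr j hj).1, (hfr j hj).2, hF₁.arr 2 rfl, hF₁.arr 4 rfl]
      exact ⟨rfl, rfl⟩
    · refine hok.imp_left fun ⟨h4, hc⟩ => ⟨h4, Z, hZr, by omega, fun i hi => ?_⟩
      refine (hset i hi).resolve_left fun h => ?_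
      obtain ⟨z, hz, hzD⟩ := hc i hi
      have := h.2 z hz
      omega

end RProg

/-! ### Graph search in a clustered matrix

Array `5` holds for each center the row of its cluster that was processed last, array `6` the stack
of the search, whose height is in register `13`. Register `12` holds the source. -/

theorem view_setArr (s : RState) (tr : Bool) (a i j v i' j' : ℕ) :
    view tr ((s.setArr a (bif tr then j else i) (bif tr then i else j) v).arr a) i' j' =
      if i' = i ∧ j' = j then v else view tr (s.arr a) i' j' := by
  cases tr <;> simp [view, and_comm]

/-- The configuration `s'` arises from `s` by marking columns `k` with `P k` in row `src` of the
output and pushing them. -/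
structure Visited (tr : Bool) (n src : ℕ) (P : ℕ → Prop) (s s' : RState) : Prop where
  le : s.reg 13 ≤ s'.reg 13
  old : ∀ q < s.reg 13, s'.arr 6 q 0 = s.arr 6 q 0
  pushed : ∀ q, s.reg 13 ≤ q → q < s'.reg 13 → P (s'.arr 6 q 0)
  mark : ∀ k, view tr (s'.arr 1) src k = view tr (s.arr 1) src k ∨
    view tr (s'.arr 1) src k = 1 ∧ P k ∧ ∃ q, s.reg 13 ≤ q ∧ q < s'.reg 13 ∧ s'.arr 6 q 0 = k
  rows : ∀ i k, i ≠ src → view tr (s'.arr 1) i k = view tr (s.arr 1) i k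
  card : s'.reg 13 + ((Finset.range n).filter fun k => view tr (s'.arr 1) src k = 0).card ≤
    s.reg 13 + ((Finset.range n).filter fun k => view tr (s.arr 1) src k = 0).card

namespace Visited

variable {tr : Bool} {n src : ℕ} {P : ℕ → Prop} {s s' s'' : RState}

theorem of_eq (h13 : s'.reg 13 = s.reg 13) (h1 : s'.arr 1 = s.arr 1) (h6 : s'.arr 6 = s.arr 6) :
    Visited tr n src P s s' where
  le := h13.ge
  old q _ := by rw [h6]
  pushed q h h' := by omega
  mark k := .inl (by rw [h1])
  rows i k _ := by rw [h1]
  card := by rw [h13, h1]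

theorem trans (h : Visited tr n src P s s') (h' : Visited tr n src P s' s'') : Visited tr n src P s s'' where
  le := h.le.trans h'.le
  old q hq := (h'.old q (hq.trans_le h.le)).trans (h.old q hq)
  pushed q h₁ h₂ := by
    by_cases hq : q < s'.reg 13
    · rw [h'.old q hq]
      exact h.pushed q h₁ hq
    · exact h'.pushed q (by omega) h₂
  mark k := by
    rcases h'.mark k with e | ⟨e, hP, q, h₁, h₂, h₃⟩
    · rcases h.mark k with e' | ⟨e', hP, q, h₁, h₂, h₃⟩
      · exact .inl (e.trans e')
      · exact .inr ⟨e.trans e', hP, q, h₁, h₂.trans_le h'.le, (h'.old q h₂).trans h₃⟩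
    · exact .inr ⟨e, hP, q, h.le.trans h₁, h₂, h₃⟩
  rows i k hi := (h'.rows i k hi).trans (h.rows i k hi)
  card := h'.card.trans h.card

theorem mark_mono (h : Visited tr n src P s s') {k : ℕ} (hk : view tr (s.arr 1) src k = 1) :
    view tr (s'.arr 1) src k = 1 :=
  (h.mark k).elim (fun e => e.trans hk) And.left

theorem mark_bool (h : Visited tr n src P s s')
    (hs : ∀ k, view tr (s.arr 1) src k = 0 ∨ view tr (s.arr 1) src k = 1) (k : ℕ) :
    view tr (s'.arr 1) src k = 0 ∨ view tr (s'.arr 1) src k = 1 :=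
  (h.mark k).elim (fun e => e ▸ hs k) fun h => .inr h.1

end Visited

/-! ### Search from one source and from all sources -/

namespace RProg

variable {ω : ℕ → Bool} {s : RState}

/-- If the row in register `7` has an entry in the column in register `8`, then mark and push this
column, unless it is already marked. -/
def visit (tr : Bool) : RProg :=
  .seq (loadIn tr 9 7 8) (.ite (.eq 9 3)
    (.seq (.load 9 1 (bif tr then 8 else 12) (bif tr then 12 else 8)) (.ite (.eq 9 2)
      (.seq (.store 1 (bif tr then 8 else 12) (bif tr then 12 else 8) 3)
        (.seq (.store 6 13 2 8) (.inc 13)))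
      .skip))
    .skip)

/-- A column is marked when it is pushed, so the stack height plus the number of unmarked columns
does not grow. -/
theorem wp_visit {tr : Bool} {n src i k : ℕ} {A : ℕ → ℕ → ℕ} (h2 : s.reg 2 = 0) (h3 : s.reg 3 = 1)
    (h7 : s.reg 7 = i) (h8 : s.reg 8 = k) (h12 : s.reg 12 = src) (hA : view tr (s.arr 0) = A)
    (hAn : ∀ k, A i k = 1 → k < n)
    (hb : ∀ k, view tr (s.arr 1) src k = 0 ∨ view tr (s.arr 1) src k = 1) :
    Wp ω (visit tr) s fun t s' => t ≤ 7 ∧ Visited tr n src (A i · = 1) s s' ∧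
      (A i k = 1 → view tr (s'.arr 1) src k = 1) := by
  simp only [visit, wp_seq, wp_loadIn, h7, h8, hA]
  refine wp_ite ?_ ?_
  · intro hh
    simp only [RTest.Holds, RState.setReg_reg, h3] at hh
    simp at hh
    have e : ∀ s' : RState, s'.arr 1 = s.arr 1 → s'.reg 12 = src → s'.reg 8 = k →
        s'.arr 1 (s'.reg (bif tr then 8 else 12)) (s'.reg (bif tr then 12 else 8)) =
          view tr (s.arr 1) src k := by
      intro s' e1 e2 e3
      cases tr <;> simp [e1, e2, e3, view]
    simp only [wp_seq, wp_load]
    rw [e (s.setReg 9 (A i k)) rfl (by simp [h12]) (by simp [h8])]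
    refine wp_ite ?_ ?_
    · intro hm
      simp only [RTest.Holds, RState.setReg_reg, h2] at hm
      simp at hm
      simp only [wp_seq, wp_store, wp_inc]
      set s₁ := (s.setReg 9 (A i k)).setReg 9 (view tr (s.arr 1) src k)
      have e1 : s₁.reg (bif tr then 8 else 12) = bif tr then k else src := by
        cases tr <;> simp [s₁, h8, h12]
      have e2 : s₁.reg (bif tr then 12 else 8) = bif tr then src else k := by
        cases tr <;> simp [s₁, h8, h12]
      have e3 : s₁.reg 3 = 1 := by simp [s₁, h3]
      rw [e1, e2, e3]
      set s₂ := s₁.setArr 1 (bif tr then k else src) (bif tr then src else k) 1 with hs₂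
      have r2 : s₂.reg 2 = 0 := by simp [s₂, s₁, h2]
      have r8 : s₂.reg 8 = k := by simp [s₂, s₁, h8]
      have r13 : s₂.reg 13 = s.reg 13 := by simp [s₂, s₁]
      have hv : ∀ i' k', view tr (s₂.arr 1) i' k' =
          if i' = src ∧ k' = k then 1 else view tr (s.arr 1) i' k' :=
        fun i' k' => view_setArr s₁ tr 1 src k 1 i' k'
      have h6 : s₂.arr 6 = s.arr 6 := by
        funext p q
        simp [s₂, s₁]
      rw [r2, r8, r13]
      set s₃ := s₂.setArr 6 (s.reg 13) 0 k with hs₃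
      have hv3 : s₃.arr 1 = s₂.arr 1 := by
        funext p q
        simp [s₃]
      have h63 : ∀ q, s₃.arr 6 q 0 = if q = s.reg 13 then k else s.arr 6 q 0 := by
        intro q
        simp [s₃, h6]
      have r3 : s₃.reg 13 = s.reg 13 := r13
      refine ⟨by omega, ⟨?_, ?_, ?_, ?_, ?_, ?_⟩, ?_⟩
      · simp [r3]
      · intro q hq
        simp [h63, hq.ne]
      · intro q hq hq'
        simp [r3] at hq'
        obtain rfl : q = s.reg 13 := by omega
        simpa [h63] using hh
      · intro k'
        by_cases hk : k' = k
        · subst hk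
          exact .inr ⟨by simp [hv3, hv], hh, s.reg 13, le_rfl, by simp [r3], by simp [h63]⟩
        · exact .inl (by simp [hv3, hv, hk])
      · intro i' k' hi
        simp [hv3, hv, hi]
      · have hmem : k ∈ (Finset.range n).filter fun k => view tr (s.arr 1) src k = 0 := by
          simp [hm, hAn k hh]
        have := Finset.card_erase_add_one hmem
        have hE : ((Finset.range n).filter fun k' => view tr (s₃.arr 1) src k' = 0) =
            ((Finset.range n).filter fun k => view tr (s.arr 1) src k = 0).erase k := by
          ext k'
          by_cases hk : k' = k <;> simp [hv3, hv, hk]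
        simp only [RState.setReg_reg, RState.setReg_arr, if_true, hE, r3]
        omega
      · intro _
        simp [hv3, hv]
    · intro hm
      simp only [RTest.Holds, RState.setReg_reg, h2] at hm
      simp at hm
      rw [wp_skip]
      refine ⟨by omega, .of_eq (by simp) rfl rfl, fun _ => ?_⟩
      exact (hb k).resolve_left hm
  · intro hh
    simp only [RTest.Holds, RState.setReg_reg, h3] at hh
    simp at hh
    rw [wp_skip]
    exact ⟨by omega, .of_eq (by simp) rfl rfl, fun h => absurd h hh⟩

/-- Visit the columns in the list whose number is in register `14`. -/
def scanList (tr : Bool) : RProg :=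
  .seq (.load 17 4 14 2) (forLoop 16 17 (.seq (.load 8 2 14 16) (visit tr)))

/-- The list `f` need not belong to row `i`: `visit` tests each listed column against row `i`. -/
theorem wp_scanList {tr : Bool} {n src i f m : ℕ} {A : ℕ → ℕ → ℕ} (h2 : s.reg 2 = 0)
    (h3 : s.reg 3 = 1) (h7 : s.reg 7 = i) (h12 : s.reg 12 = src) (h14 : s.reg 14 = f)
    (hm : s.arr 4 f 0 = m) (hA : view tr (s.arr 0) = A) (hAn : ∀ k, A i k = 1 → k < n)
    (hb : ∀ k, view tr (s.arr 1) src k = 0 ∨ view tr (s.arr 1) src k = 1) :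
    Wp ω (scanList tr) s fun t s' => t ≤ m * 10 + 3 ∧ Visited tr n src (A i · = 1) s s' ∧
      ∀ p < m, A i (s.arr 2 f p) = 1 → view tr (s'.arr 1) src (s.arr 2 f p) = 1 := by
  simp only [scanList, wp_seq, wp_load, h14, h2, hm]
  refine (wp_forLoop (N := m) (T := 8) (fun p s' => Visited tr n src (A i · = 1) s s' ∧
    ∀ p' < p, A i (s.arr 2 f p') = 1 → view tr (s'.arr 1) src (s.arr 2 f p') = 1) (fun _ => 0)
    rfl rfl (by simp) ?_ ?_).mono ?_
  · exact ⟨.of_eq (by simp) rfl rfl, by simp⟩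
  · rintro p s' hp h16 h17 hF ⟨hE, hI⟩
    have g14 : s'.reg 14 = f := by rw [hF.reg 14 rfl]; simp [h14]
    have g2 : s'.reg 2 = 0 := by rw [hF.reg 2 rfl]; simp [h2]
    have g3 : s'.reg 3 = 1 := by rw [hF.reg 3 rfl]; simp [h3]
    have g7 : s'.reg 7 = i := by rw [hF.reg 7 rfl]; simp [h7]
    have g12 : s'.reg 12 = src := by rw [hF.reg 12 rfl]; simp [h12]
    have gA : view tr (s'.arr 0) = A := by rw [hF.arr 0 rfl]; simp [hA]
    have ga : s'.arr 2 = s.arr 2 := by rw [hF.arr 2 rfl]; rfl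
    simp only [wp_seq, wp_load, g14, h16, ga]
    refine (wp_visit (n := n) (src := src) (i := i) (k := s.arr 2 f p) (A := A) (by simp [g2])
      (by simp [g3]) (by simp [g7]) (by simp) (by simp [g12]) (by exact gA) hAn
      (by exact hE.mark_bool hb)).mono ?_
    rintro t s'' hF' ⟨ht, hE', hk⟩
    have hE'' : Visited tr n src (A i · = 1) s' s'' :=
      Visited.trans (s' := s'.setReg 8 (s.arr 2 f p)) (.of_eq (by simp) rfl rfl) hE'
    refine ⟨⟨(hE.trans hE'').trans (.of_eq (by simp) rfl rfl), fun p' hp' h => ?_⟩, by omega⟩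
    rcases Nat.lt_succ_iff_lt_or_eq.mp hp' with hlt | rfl
    · exact hE''.mark_mono (hI p' hlt h)
    · exact hk h
  · rintro t s' - ⟨⟨hE, hI⟩, ht⟩
    exact ⟨by omega, hE, hI⟩

/-- Pop a row and visit its out-neighbours. -/
def popRow (tr : Bool) : RProg :=
  .seq (.dec 13) (.seq (.load 7 6 13 2) (.seq (.load 18 3 7 2) (.seq (.load 14 5 18 2)
    (.seq (scanList tr) (.seq (.copy 14 7) (.seq (scanList tr) (.store 5 18 2 7)))))))

/-- The configuration is ready for a search in the matrix `A`, whose rows are in clusters with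
centers `Z`. -/
structure Ready (tr : Bool) (n D : ℕ) (A : ℕ → ℕ → ℕ) (Z : Finset ℕ) (s : RState) : Prop where
  reg0 : s.reg 0 = n
  reg2 : s.reg 2 = 0
  reg3 : s.reg 3 = 1
  input : view tr (s.arr 0) = A
  assigned : ∀ i < n, Assigned n D A Z s.arr i
  full_len : s.arr 4 n 0 = n
  full : ∀ p < n, s.arr 2 n p = p

theorem Ready.congr {tr : Bool} {n D : ℕ} {A : ℕ → ℕ → ℕ} {Z : Finset ℕ} {s s' : RState}
    (h : Ready tr n D A Z s) (h0 : s'.reg 0 = s.reg 0) (h2 : s'.reg 2 = s.reg 2)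
    (h3 : s'.reg 3 = s.reg 3) (a0 : s'.arr 0 = s.arr 0) (a2 : s'.arr 2 = s.arr 2)
    (a3 : s'.arr 3 = s.arr 3) (a4 : s'.arr 4 = s.arr 4) : Ready tr n D A Z s' where
  reg0 := h0.trans h.reg0
  reg2 := h2.trans h.reg2
  reg3 := h3.trans h.reg3
  input := a0 ▸ h.input
  assigned i hi := by
    have := h.assigned i hi
    exact ⟨by rw [a3]; exact this.mem, by rw [a4]; exact this.len_le,
      by rw [a3]; exact this.dist_le, by rw [a2, a3, a4]; exact this.diff⟩
  full_len := by rw [a4, h.full_len]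
  full := by rw [a2]; exact h.full

/-- The invariant of the search from `src`; `out` is the output array at its start. -/
structure SearchInv (tr : Bool) (n src : ℕ) (A out : ℕ → ℕ → ℕ) (s : RState) : Prop where
  stack : ∀ q < s.reg 13, s.arr 6 q 0 < n ∧
    (s.arr 6 q 0 = src ∨ Relation.TransGen (A · · = 1) src (s.arr 6 q 0))
  mark : ∀ k, view tr (s.arr 1) src k = 0 ∨
    view tr (s.arr 1) src k = 1 ∧ Relation.TransGen (A · · = 1) src k
  closed : ∀ k, k = src ∨ view tr (s.arr 1) src k = 1 → (∃ q < s.reg 13, s.arr 6 q 0 = k) ∨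
    ∀ k', A k k' = 1 → view tr (s.arr 1) src k' = 1
  last : ∀ r < n, s.arr 5 r 0 = n ∨ s.arr 5 r 0 < n ∧ s.arr 3 (s.arr 5 r 0) 0 = r ∧
    ∀ k', A (s.arr 5 r 0) k' = 1 → view tr (s.arr 1) src k' = 1
  rows : ∀ i k, i ≠ src → view tr (s.arr 1) i k = view tr out i k

/-- The potential of the search. -/
def searchPotential (tr : Bool) (n D src : ℕ) (Z : Finset ℕ) (s : RState) : ℕ :=
  (s.reg 13 + ((Finset.range n).filter fun k => view tr (s.arr 1) src k = 0).card) *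
    (D * 20 + 14) + (Z.filter fun z => s.arr 5 z 0 = n).card * (n * 10)

/-- A pop lowers the stack height plus the number of unmarked columns by at least one, which
releases enough for two lists of length at most `D`. If the first list is that of all columns, the
cluster is met for the first time, and the `n * 10` reserved for its center pays. -/
theorem wp_popRow {tr : Bool} {n D src : ℕ} {A out : ℕ → ℕ → ℕ} {Z : Finset ℕ}
    (hR : Ready tr n D A Z s) (h12 : s.reg 12 = src) (hZ : ∀ z ∈ Z, z < n)
    (hAn : ∀ i k, A i k = 1 → k < n) (hI : SearchInv tr n src A out s) (h13 : 0 < s.reg 13) :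
    Wp ω (popRow tr) s fun t s' => SearchInv tr n src A out s' ∧
      t + 1 + searchPotential tr n D src Z s' ≤ searchPotential tr n D src Z s := by
  obtain ⟨sp, hsp⟩ : ∃ sp, s.reg 13 = sp + 1 := ⟨s.reg 13 - 1, by omega⟩
  obtain ⟨i, hi⟩ : ∃ i, s.arr 6 sp 0 = i := ⟨_, rfl⟩
  obtain ⟨r, hr⟩ : ∃ r, s.arr 3 i 0 = r := ⟨_, rfl⟩
  -- The row of this cluster processed last, or `n`, whose list consists of all columns.
  obtain ⟨f, hf⟩ : ∃ f, s.arr 5 r 0 = f := ⟨_, rfl⟩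
  have hin : i < n := hi ▸ (hI.stack sp (by omega)).1
  have hreach : ∀ k, A i k = 1 → Relation.TransGen (A · · = 1) src k := by
    intro k hk
    rcases (hI.stack sp (by omega)).2 with h | h <;> rw [hi] at h
    · subst h
      exact .single hk
    · exact h.tail hk
  have hasg := hR.assigned i hin
  have hrZ : r ∈ Z := hr ▸ hasg.mem
  have hb : ∀ k, view tr (s.arr 1) src k = 0 ∨ view tr (s.arr 1) src k = 1 :=
    fun k => (hI.mark k).imp_right And.left
  simp only [popRow, wp_seq, wp_dec, wp_load]
  simp [hsp, hR.reg2, hi, hr, hf]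
  set s₁ := (((s.setReg 13 sp).setReg 7 i).setReg 18 r).setReg 14 f with hs₁
  have hE₀ : s₁.reg 13 = sp := by simp [s₁]
  refine (wp_scanList (n := n) (src := src) (i := i) (f := f) (m := s.arr 4 f 0) (A := A)
    (by simp [s₁, hR.reg2]) (by simp [s₁, hR.reg3]) (by simp [s₁]) (by simp [s₁, h12])
    (by simp [s₁]) (by rfl) (by exact hR.input) (hAn i) (by exact hb)).mono ?_
  rintro t₂ s₂ hF₂ ⟨ht₂, hE₂, hm₂⟩
  set s₃ := s₂.setReg 14 (s₂.reg 7) with hs₃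
  have a4 : s₃.arr 4 = s.arr 4 := hF₂.arr 4 rfl
  have a2 : s₃.arr 2 = s.arr 2 := hF₂.arr 2 rfl
  have q2 : s₃.reg 2 = 0 := by simp [s₃, hF₂.reg 2 rfl, s₁, hR.reg2]
  have q3 : s₃.reg 3 = 1 := by simp [s₃, hF₂.reg 3 rfl, s₁, hR.reg3]
  have q7 : s₃.reg 7 = i := by simp [s₃, hF₂.reg 7 rfl, s₁]
  have q12 : s₃.reg 12 = src := by simp [s₃, hF₂.reg 12 rfl, s₁, h12]
  have q14 : s₃.reg 14 = i := by simp [s₃, hF₂.reg 7 rfl, s₁]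
  have q18 : s₃.reg 18 = r := by simp [s₃, hF₂.reg 18 rfl, s₁]
  have hE₃ : Visited tr n src (A i · = 1) s₁ s₃ := hE₂.trans (.of_eq (by simp [s₃]) rfl rfl)
  refine (wp_scanList (n := n) (src := src) (i := i) (f := i) (m := s.arr 4 i 0) (A := A)
    q2 q3 q7 q12 q14 (by rw [a4]) ((hF₂.arr 0 rfl ▸ hR.input :)) (hAn i)
    (hE₃.mark_bool hb)).mono ?_
  rintro t₄ s₄ hF₄ ⟨ht₄, hE₄, hm₄⟩
  rw [a2] at hm₄
  rw [hF₄.reg 18 rfl, hF₄.reg 2 rfl, hF₄.reg 7 rfl, q18, q2, q7]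
  have hE : Visited tr n src (A i · = 1) s₁ s₄ := hE₃.trans hE₄
  set s₅ := s₄.setArr 5 r 0 i with hs₅
  have b1 : s₅.arr 1 = s₄.arr 1 := by funext p q; simp [s₅]
  have b3 : s₅.arr 3 = s.arr 3 := by
    rw [show s.arr 3 = s₄.arr 3 from ((hF₄.arr 3 rfl).trans (hF₂.arr 3 rfl)).symm]
    funext p q
    simp [s₅]
  have b6 : s₅.arr 6 = s₄.arr 6 := by funext p q; simp [s₅]
  have b5 : ∀ z, s₅.arr 5 z 0 = if z = r then i else s.arr 5 z 0 := by
    intro z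
    rw [show s.arr 5 = s₄.arr 5 from ((hF₄.arr 5 rfl).trans (hF₂.arr 5 rfl)).symm]
    simp [s₅]
  have b13 : s₅.reg 13 = s₄.reg 13 := rfl
  have hE₅ : Visited tr n src (A i · = 1) s₁ s₅ := hE.trans (.of_eq b13 b1 b6)
  have hfdef : f = n ∨ f < n ∧ s.arr 3 f 0 = r ∧
      ∀ k', A f k' = 1 → view tr (s.arr 1) src k' = 1 := by
    have := hI.last r (hZ r hrZ)
    rwa [hf] at this
  -- Either `k` is in the list of `f` or of `i`, or both rows agree with the center in `k`; then `k`
  -- is an out-neighbour of `f` and already marked.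
  have hdone : ∀ k, A i k = 1 → view tr (s₅.arr 1) src k = 1 := by
    intro k hk
    have hkn := hAn i k hk
    rw [b1]
    rcases hfdef with hfn | ⟨hfn, hcen, hfmark⟩
    · have e : s₁.arr 2 f k = k := by rw [hfn]; exact hR.full k hkn
      have h := hm₂ k (by rw [hfn, hR.full_len]; exact hkn)
      rw [e] at h
      exact hE₄.mark_mono (h hk)
    · by_cases h₁ : A i k = A r k
      · by_cases h₂ : A f k = A r k
        · exact hE.mark_mono (hfmark k (by rw [h₂, ← h₁, hk]))
        · obtain ⟨p, hp, hpk⟩ := (hR.assigned f hfn).diff.cover k hkn (by rwa [hcen])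
          have h := hm₂ p hp
          rw [show s₁.arr 2 f p = k from hpk] at h
          exact hE₄.mark_mono (h hk)
      · obtain ⟨p, hp, hpk⟩ := hasg.diff.cover k hkn (by rwa [hr])
        have h := hm₄ p hp
        rw [hpk] at h
        exact h hk
  refine ⟨⟨?_, ?_, ?_, ?_, ?_⟩, ?_⟩
  · intro q hq
    by_cases hq' : q < sp
    · have e : s₅.arr 6 q 0 = s.arr 6 q 0 := hE₅.old q (by omega)
      rw [e]
      exact hI.stack q (by omega)
    · have h := hE₅.pushed q (by omega) hq
      exact ⟨hAn i _ h, .inr (hreach _ h)⟩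
  · intro k
    rcases hE₅.mark k with e | ⟨e, hk, -⟩
    · rw [e]
      exact hI.mark k
    · exact .inr ⟨e, hreach k hk⟩
  · intro k hk
    by_cases hki : k = i
    · subst hki
      exact .inr hdone
    have old : k = src ∨ view tr (s.arr 1) src k = 1 → (∃ q < s₅.reg 13, s₅.arr 6 q 0 = k) ∨
        ∀ k', A k k' = 1 → view tr (s₅.arr 1) src k' = 1 := by
      intro h
      rcases hI.closed k h with ⟨q, hq, hqk⟩ | h
      · have hqsp : q ≠ sp := fun e => hki (by rw [← hqk, e, hi])
        have hlt : q < s₁.reg 13 := by omega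
        exact .inl ⟨q, hlt.trans_le hE₅.le, (hE₅.old q hlt).trans hqk⟩
      · exact .inr fun k' hk' => hE₅.mark_mono (h k' hk')
    rcases hk with hk | hk
    · exact old (.inl hk)
    · rcases hE₅.mark k with e | ⟨-, -, q, -, hq, hqk⟩
      · exact old (.inr (e ▸ hk))
      · exact .inl ⟨q, hq, hqk⟩
  · intro z hz
    rw [b5]
    by_cases hzr : z = r
    · rw [if_pos hzr, b3, hr]
      exact .inr ⟨hin, hzr.symm, hdone⟩
    · rw [if_neg hzr, b3]
      exact (hI.last z hz).imp_right fun ⟨h₁, h₂, h₃⟩ =>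
        ⟨h₁, h₂, fun k' hk' => hE₅.mark_mono (h₃ k' hk')⟩
  · intro i' k hi'
    exact (hE₅.rows i' k hi').trans (hI.rows i' k hi')
  · have hc := hE₅.card
    rw [hE₀] at hc
    have hlen := hasg.len_le
    simp only [searchPotential, hsp]
    set u' := s₅.reg 13 + ((Finset.range n).filter fun k => view tr (s₅.arr 1) src k = 0).card
    have hc' : u' ≤ sp + ((Finset.range n).filter fun k => view tr (s.arr 1) src k = 0).card := hc
    set u := ((Finset.range n).filter fun k => view tr (s.arr 1) src k = 0).card
    have hmul := Nat.mul_le_mul_right (D * 20 + 14) hc'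
    have e1 : (sp + 1 + u) * (D * 20 + 14) = (sp + u) * (D * 20 + 14) + (D * 20 + 14) := by ring
    rw [e1]
    clear_value u u'
    have hsub : (Z.filter fun z => s₅.arr 5 z 0 = n) =
        (Z.filter fun z => s.arr 5 z 0 = n).erase r := by
      ext z
      by_cases hz : z = r <;> simp [b5, hz, hin.ne]
    rw [hsub]
    rcases hfdef with hfn | ⟨hfn, -, -⟩
    · have hmem : r ∈ Z.filter fun z => s.arr 5 z 0 = n := by simp [hrZ, hf, hfn]
      have hce := Finset.card_erase_add_one hmem
      rw [hfn, hR.full_len] at ht₂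
      rw [← hce, Nat.succ_mul]
      omega
    · have hle := Nat.mul_le_mul_right (n * 10)
        (Finset.card_le_card (Finset.erase_subset r (Z.filter fun z => s.arr 5 z 0 = n)))
      have := (hR.assigned f hfn).len_le
      omega

/-- Mark in the row in register `12` of the output everything that is reachable from there. -/
def searchFrom (tr : Bool) : RProg :=
  .seq (forLoop 7 0 (.store 5 7 2 0)) (.seq (.const 13 0) (.seq (.store 6 13 2 12)
    (.seq (.inc 13) (.while (.lt 2 13) (popRow tr)))))

/-- The source is pushed without being marked, so it gets marked only if it lies on a cycle. It may
then be pushed again, whence the factor `n + 1`. -/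
theorem wp_searchFrom {tr : Bool} {n D src : ℕ} {A : ℕ → ℕ → ℕ} {Z : Finset ℕ}
    (hR : Ready tr n D A Z s) (h12 : s.reg 12 = src) (hsrc : src < n) (hZ : ∀ z ∈ Z, z < n)
    (hZD : Z.card ≤ D) (hAn : ∀ i k, A i k = 1 → k < n)
    (h0 : ∀ k, view tr (s.arr 1) src k = 0) :
    Wp ω (searchFrom tr) s fun t s' => t ≤ (n + 1) * (D * 20 + 14) + D * (n * 10) + n * 3 + 6 ∧
      (∀ i k, i ≠ src → view tr (s'.arr 1) i k = view tr (s.arr 1) i k) ∧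
      (∀ k, view tr (s'.arr 1) src k = 0 ∨ view tr (s'.arr 1) src k = 1) ∧
      ∀ k, view tr (s'.arr 1) src k = 1 ↔ Relation.TransGen (A · · = 1) src k := by
  rw [searchFrom, wp_seq]
  refine (wp_forLoop (N := n) (T := 1) (fun i s' => ∀ j < i, s'.arr 5 j 0 = n)
    (fun _ => 0) rfl rfl hR.reg0 (by simp) ?_).mono ?_
  · rintro i s' hi h7 h0' hF hl
    simp only [wp_store]
    refine ⟨fun j hj => ?_, by omega⟩
    have : s'.reg 2 = 0 := by rw [hF.reg 2 rfl, hR.reg2]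
    simp only [RState.setReg_arr, RState.setArr_arr, h7, this, h0']
    split_ifs with h
    · rfl
    · exact hl j (by simp at h; omega)
  rintro t₁ s₁ hF₁ ⟨hl, ht₁⟩
  simp only [wp_seq, wp_const, wp_store, wp_inc]
  have e2 : s₁.reg 2 = 0 := by rw [hF₁.reg 2 rfl, hR.reg2]
  have e12 : s₁.reg 12 = src := by rw [hF₁.reg 12 rfl, h12]
  simp [e2, e12]
  set s₂ := ((s₁.setReg 13 0).setArr 6 0 0 src).setReg 13 1 with hs₂
  have a : ∀ x, x ≠ 6 → s₂.arr x = s₁.arr x := by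
    intro x hx
    funext p q
    simp [s₂, hx]
  have a1 : s₂.arr 1 = s.arr 1 := by rw [a 1 (by decide), hF₁.arr 1 rfl]
  have hR₂ : Ready tr n D A Z s₂ := by
    refine hR.congr ?_ ?_ ?_ ?_ ?_ ?_ ?_
    · simp [s₂, hF₁.reg 0 rfl]
    · simp [s₂, hF₁.reg 2 rfl]
    · simp [s₂, hF₁.reg 3 rfl]
    · rw [a 0 (by decide), hF₁.arr 0 rfl]
    · rw [a 2 (by decide), hF₁.arr 2 rfl]
    · rw [a 3 (by decide), hF₁.arr 3 rfl]
    · rw [a 4 (by decide), hF₁.arr 4 rfl]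
  refine (wp_while (SearchInv tr n src A (s.arr 1)) (searchPotential tr n D src Z) ?_ ?_).mono ?_
  · refine ⟨fun q hq => ?_, fun k => ?_, fun k hk => ?_, fun r hr => ?_, fun i k _ => by rw [a1]⟩
    · obtain rfl : q = 0 := by simpa [s₂] using hq
      simp [s₂, hsrc]
    · rw [a1]
      exact .inl (h0 k)
    · rw [a1, h0] at hk
      exact .inl ⟨0, by simp [s₂], by simpa [s₂, eq_comm] using hk⟩
    · rw [a 5 (by decide)]
      exact .inl (hl r hr)
  · intro s' hI hh hF
    have hR' : Ready tr n D A Z s' := hR₂.congr (hF.reg 0 rfl) (hF.reg 2 rfl) (hF.reg 3 rfl)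
      (hF.arr 0 rfl) (hF.arr 2 rfl) (hF.arr 3 rfl) (hF.arr 4 rfl)
    refine wp_popRow hR' ?_ hZ hAn hI ?_
    · rw [hF.reg 12 rfl]
      simp [s₂, e12]
    · simpa [RTest.Holds, hR'.reg2] using hh
  · rintro t s' hF ⟨hI, hh, ht⟩
    have hz : s'.reg 13 = 0 := by
      have : s'.reg 2 = 0 := by rw [hF.reg 2 rfl, hR₂.reg2]
      simpa [RTest.Holds, this] using hh
    -- With an empty stack, the source and the marked vertices are closed under out-neighbours.
    have hcl : ∀ k, k = src ∨ view tr (s'.arr 1) src k = 1 →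
        ∀ k', A k k' = 1 → view tr (s'.arr 1) src k' = 1 := by
      intro k hk
      refine (hI.closed k hk).resolve_left ?_
      rintro ⟨q, hq, -⟩
      omega
    refine ⟨?_, hI.rows, fun k => (hI.mark k).imp_right And.left, fun k => ⟨fun hk => ?_,
      fun hk => ?_⟩⟩
    · have h1 : searchPotential tr n D src Z s₂ ≤ (n + 1) * (D * 20 + 14) + D * (n * 10) := by
        refine Nat.add_le_add (Nat.mul_le_mul_right _ ?_) (Nat.mul_le_mul_right _ ?_)
        · have := Finset.card_filter_le (Finset.range n) fun k => view tr (s₂.arr 1) src k = 0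
          rw [Finset.card_range] at this
          have e : s₂.reg 13 = 1 := by simp [s₂]
          omega
        · exact (Finset.card_filter_le _ _).trans hZD
      omega
    · rcases hI.mark k with h | h
      · omega
      · exact h.2
    · induction hk with
      | single h => exact hcl src (.inl rfl) _ h
      | tail _ h ih => exact hcl _ (.inr ih) _ h

/-- Search from all vertices. -/
def search (tr : Bool) : RProg := forLoop 12 0 (searchFrom tr)

open Classical in
theorem wp_search {tr : Bool} {n D : ℕ} {A : ℕ → ℕ → ℕ} {Z : Finset ℕ}
    (hR : Ready tr n D A Z s) (hZ : ∀ z ∈ Z, z < n)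
    (hZD : Z.card ≤ D) (hAn : ∀ i k, A i k = 1 → k < n)
    (h0 : ∀ i k, view tr (s.arr 1) i k = 0) :
    Wp ω (search tr) s fun t s' =>
      t ≤ n * ((n + 1) * (D * 20 + 14) + D * (n * 10) + n * 3 + 8) + 2 ∧
      ∀ i < n, ∀ k, view tr (s'.arr 1) i k =
        if Relation.TransGen (A · · = 1) i k then 1 else 0 := by
  refine (wp_forLoop (N := n) (T := (n + 1) * (D * 20 + 14) + D * (n * 10) + n * 3 + 6)
    (fun src s' => (∀ i < src, ∀ k, view tr (s'.arr 1) i k =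
      if Relation.TransGen (A · · = 1) i k then 1 else 0) ∧
      ∀ i, src ≤ i → ∀ k, view tr (s'.arr 1) i k = 0)
    (fun _ => 0) rfl rfl hR.reg0 (by simpa using h0) ?_).mono ?_
  · rintro src s' hsrc h12 - hF ⟨hl, hr⟩
    have hR' : Ready tr n D A Z s' := hR.congr (hF.reg 0 rfl) (hF.reg 2 rfl) (hF.reg 3 rfl)
      (hF.arr 0 rfl) (hF.arr 2 rfl) (hF.arr 3 rfl) (hF.arr 4 rfl)
    refine (wp_searchFrom hR' h12 hsrc hZ hZD hAn (hr src le_rfl)).mono ?_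
    rintro t s'' - ⟨ht, hrows, hbool, hiff⟩
    refine ⟨⟨fun i hi k => ?_, fun i hi k => ?_⟩, by omega⟩
    · rcases Nat.lt_succ_iff_lt_or_eq.mp hi with h | rfl
      · exact (hrows i k h.ne).trans (hl i h k)
      · split_ifs with h
        · exact (hiff k).mpr h
        · exact (hbool k).resolve_right fun h' => h ((hiff k).mp h')
    · exact (hrows i k (by omega)).trans (hr i (by omega) k)
  · rintro t s' - ⟨⟨hl, -⟩, ht⟩
    exact ⟨by simpa using ht, hl⟩

end RProg

/-! ### The transitive closure -/

namespace RProg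

variable {ω : ℕ → Bool} {s : RState}

/-- Double the threshold. -/
def double : RProg := .seq (.copy 18 1) (.while (.lt 2 18) (.seq (.inc 1) (.dec 18)))

/-- Two numbers cannot be added in one step, so doubling takes `D` increments. -/
theorem wp_double {D : ℕ} (h1 : s.reg 1 = D) (h2 : s.reg 2 = 0) :
    Wp ω double s fun t s' => t ≤ D * 3 + 2 ∧ s'.reg 1 = D * 2 := by
  rw [double, wp_seq, wp_copy]
  refine (wp_while (fun s' => s'.reg 1 + s'.reg 18 = D * 2) (fun s' => s'.reg 18 * 3)
    (by simp [h1]; omega) ?_).mono ?_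
  · intro s' hI hh hF
    have g2 : s'.reg 2 = 0 := by rw [hF.reg 2 rfl]; simp [h2]
    simp only [RTest.Holds, g2] at hh
    simp only [wp_seq, wp_inc, wp_dec]
    simp
    omega
  · rintro t s' hF ⟨hI, hh, ht⟩
    have g2 : s'.reg 2 = 0 := by rw [hF.reg 2 rfl]; simp [h2]
    simp only [RTest.Holds, g2] at hh
    simp [h1] at ht
    omega

/-- Try to cluster the rows and the columns, and search if this succeeds. -/
def phase : RProg :=
  .seq (cluster false) (.ite (.eq 4 3) (search false)
    (.seq (cluster true) (.ite (.eq 4 3) (search true) double)))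

/-- Try increasing thresholds until the clustering succeeds. -/
def transClosureProg : RProg :=
  .seq (.const 1 1) (.seq (.const 3 1) (.seq (forLoop 8 0 (.store 2 0 8 8)) (.seq (.store 4 0 2 0)
    (.while (.eq 4 2) phase))))

/-- The configuration between two phases. -/
structure Idle (n : ℕ) (A : ℕ → ℕ → ℕ) (s : RState) : Prop where
  reg0 : s.reg 0 = n
  reg2 : s.reg 2 = 0
  reg3 : s.reg 3 = 1
  input : s.arr 0 = A
  full_len : s.arr 4 n 0 = n
  full : ∀ p < n, s.arr 2 n p = p

theorem Idle.congr {n : ℕ} {A : ℕ → ℕ → ℕ} {s s' : RState}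
    (h : Idle n A s) (h0 : s'.reg 0 = s.reg 0) (h2 : s'.reg 2 = s.reg 2)
    (h3 : s'.reg 3 = s.reg 3) (a0 : s'.arr 0 = s.arr 0) (a2 : s'.arr 2 n = s.arr 2 n)
    (a4 : s'.arr 4 n = s.arr 4 n) : Idle n A s' :=
  ⟨h0.trans h.reg0, h2.trans h.reg2, h3.trans h.reg3, a0.trans h.input, by rw [a4, h.full_len],
    by rw [a2]; exact h.full⟩

open Classical in
/-- The output array holds the transitive closure. -/
def Closed (n : ℕ) (A : ℕ → ℕ → ℕ) (s : RState) : Prop :=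
  ∀ i < n, ∀ j < n, s.arr 1 i j = if Relation.TransGen (A · · = 1) i j then 1 else 0

theorem wp_cluster_of_idle {tr : Bool} {n D : ℕ} {A : ℕ → ℕ → ℕ} (hI : Idle n A s)
    (h1 : s.reg 1 = D) : Wp ω (cluster tr) s fun t s' =>
      t ≤ D * (n * (n * 7 + 10) + 2) + 11 * n + 6 ∧ Idle n A s' ∧ s'.arr 1 = s.arr 1 ∧
      s'.reg 1 = D ∧ (s'.reg 4 = 1 ∧ Clustering n D (view tr A) s'.arr ∨
        s'.reg 4 = 0 ∧ Scattered n D (view tr A)) := by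
  refine (wp_cluster hI.reg0 h1 hI.reg2 rfl).mono ?_
  rintro t s' hF ⟨ht, hfr, h⟩
  rw [hI.input] at h
  exact ⟨ht, hI.congr (hF.reg 0 rfl) (hF.reg 2 rfl) (hF.reg 3 rfl) (hF.arr 0 rfl)
    (hfr n le_rfl).1 (hfr n le_rfl).2, hF.arr 1 rfl, (hF.reg 1 rfl).trans h1, h⟩

/-- For `tr = true` the search runs in the reversed graph and writes transposed, so the output is
again the closure of `A`. -/
theorem wp_search_of_idle {tr : Bool} {n D : ℕ} {A : ℕ → ℕ → ℕ} (hI : Idle n A s)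
    (hC : Clustering n D (view tr A) s.arr) (hA : ∀ i j, A i j = 1 → i < n ∧ j < n)
    (h0 : ∀ i j, s.arr 1 i j = 0) : Wp ω (search tr) s fun t s' =>
      t ≤ n * ((n + 1) * (D * 20 + 14) + D * (n * 10) + n * 3 + 8) + 2 ∧
      Idle n A s' ∧ s'.reg 4 = s.reg 4 ∧ Closed n A s' := by
  obtain ⟨Z, hZ, hZD, hasg⟩ := hC
  refine (wp_search (D := D) (A := view tr A) ⟨hI.reg0, hI.reg2, hI.reg3, by rw [hI.input], hasg,
    hI.full_len, hI.full⟩ hZ hZD ?_ ?_).mono ?_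
  · intro i k h
    cases tr
    · exact (hA i k h).2
    · exact (hA k i h).1
  · intro i k
    exact h0 _ _
  · rintro t s' hF ⟨ht, h⟩
    refine ⟨ht, hI.congr (hF.reg 0 rfl) (hF.reg 2 rfl) (hF.reg 3 rfl) (hF.arr 0 rfl)
      (congrFun (hF.arr 2 rfl) n) (congrFun (hF.arr 4 rfl) n), hF.reg 4 rfl, ?_⟩
    intro i hi j hj
    cases tr
    · exact h i hi j
    · refine (h j hj i).trans ?_
      congr 1
      exact propext Relation.transGen_swap

/-- The costliest case is two clusterings and a search; since `n` and `D` are positive, all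
lower-order terms are absorbed by `n ^ 2 * D`. -/
theorem wp_phase {n D : ℕ} {A : ℕ → ℕ → ℕ} (hn : 0 < n) (hD : 0 < D) (hI : Idle n A s)
    (h1 : s.reg 1 = D) (hA : ∀ i j, A i j = 1 → i < n ∧ j < n) (h0 : ∀ i j, s.arr 1 i j = 0) :
    Wp ω phase s fun t s' => t + 1 ≤ 170 * (n ^ 2 * D) ∧ Idle n A s' ∧
      (s'.reg 4 = 1 ∧ Closed n A s' ∨ s'.reg 4 = 0 ∧ s'.reg 1 = D * 2 ∧ s'.arr 1 = s.arr 1 ∧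
        Scattered n D (view false A) ∧ Scattered n D (view true A)) := by
  have q1 : n ≤ n ^ 2 * D := by nlinarith [Nat.mul_le_mul hn hD, Nat.mul_le_mul_left (n ^ 2) hD]
  have q2 : D ≤ n ^ 2 * D := Nat.le_mul_of_pos_left D (by positivity)
  have q3 : n ^ 2 ≤ n ^ 2 * D := Nat.le_mul_of_pos_right _ hD
  have q4 : n * D ≤ n ^ 2 * D := Nat.mul_le_mul_right D (by nlinarith)
  have e1 : D * (n * (n * 7 + 10) + 2) = 7 * (n ^ 2 * D) + 10 * (n * D) + 2 * D := by ring
  have e2 : n * ((n + 1) * (D * 20 + 14) + D * (n * 10) + n * 3 + 8) =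
      30 * (n ^ 2 * D) + 20 * (n * D) + 17 * n ^ 2 + 22 * n := by ring
  rw [phase, wp_seq]
  refine (wp_cluster_of_idle hI h1).mono ?_
  rintro t₁ s₁ - ⟨ht₁, hI₁, ho₁, hD₁, hc₁⟩
  refine wp_ite (fun hh => ?_) (fun hh => ?_)
  · simp only [RTest.Holds, hI₁.reg3] at hh
    have hC := (hc₁.resolve_right fun h => by omega).2
    refine (wp_search_of_idle hI₁ hC hA (by rwa [ho₁])).mono ?_
    rintro t₂ s₂ - ⟨ht₂, hI₂, h4, hcl⟩
    exact ⟨by omega, hI₂, .inl ⟨h4.trans hh, hcl⟩⟩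
  · simp only [RTest.Holds, hI₁.reg3] at hh
    have hS := (hc₁.resolve_left fun h => hh h.1).2
    rw [wp_seq]
    refine (wp_cluster_of_idle hI₁ hD₁).mono ?_
    rintro t₂ s₂ - ⟨ht₂, hI₂, ho₂, hD₂, hc₂⟩
    refine wp_ite (fun hh => ?_) (fun hh => ?_)
    · simp only [RTest.Holds, hI₂.reg3] at hh
      have hC := (hc₂.resolve_right fun h => by omega).2
      refine (wp_search_of_idle hI₂ hC hA (by rwa [ho₂, ho₁])).mono ?_
      rintro t₃ s₃ - ⟨ht₃, hI₃, h4, hcl⟩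
      exact ⟨by omega, hI₃, .inl ⟨h4.trans hh, hcl⟩⟩
    · simp only [RTest.Holds, hI₂.reg3] at hh
      obtain ⟨h4, hS'⟩ := hc₂.resolve_left fun h => hh h.1
      refine (wp_double hD₂ hI₂.reg2).mono ?_
      rintro t₃ s₃ hF ⟨ht₃, h1'⟩
      refine ⟨by omega, hI₂.congr (hF.reg 0 rfl) (hF.reg 2 rfl) (hF.reg 3 rfl) (hF.arr 0 rfl)
        (congrFun (hF.arr 2 rfl) n) (congrFun (hF.arr 4 rfl) n), .inr ⟨?_, h1', ?_, hS, hS'⟩⟩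
      · rw [hF.reg 4 rfl, h4]
      · rw [hF.arr 1 rfl, ho₂, ho₁]

theorem wp_transClosureProg {n X : ℕ} {A : ℕ → ℕ → ℕ} (hn : 0 < n) (hX : 0 < X)
    (hreg : s.reg = fun x => if x = 0 then n else 0) (hA0 : s.arr 0 = A)
    (hA : ∀ i j, A i j = 1 → i < n ∧ j < n) (h0 : ∀ i j, s.arr 1 i j = 0)
    (hS : ∀ D, Scattered n D (view false A) → Scattered n D (view true A) → D * 2 ≤ X) :
    Wp ω transClosureProg s fun t s' =>
      t ≤ 520 * (n ^ 2 * X) ∧ Idle n A s' ∧ Closed n A s' := by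
  simp only [transClosureProg, wp_seq, wp_const]
  refine (wp_forLoop (N := n) (T := 1) (fun p s' => ∀ p' < p, s'.arr 2 n p' = p')
    (fun _ => 0) rfl rfl (by simp [hreg]) (by simp) ?_).mono ?_
  · rintro p s' hp h8 h0' hF hl
    simp only [wp_store]
    refine ⟨fun j hj => ?_, by omega⟩
    simp only [RState.setReg_arr, RState.setArr_arr, h8, h0']
    split_ifs with h
    · exact h.2.2.symm
    · exact hl j (by simp at h; omega)
  rintro t₁ s₁ hF₁ ⟨hl, ht₁⟩
  have g0 : s₁.reg 0 = n := by rw [hF₁.reg 0 rfl]; simp [hreg]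
  have g1 : s₁.reg 1 = 1 := by rw [hF₁.reg 1 rfl]; simp
  have g2 : s₁.reg 2 = 0 := by rw [hF₁.reg 2 rfl]; simp [hreg]
  have g3 : s₁.reg 3 = 1 := by rw [hF₁.reg 3 rfl]; simp
  have g4 : s₁.reg 4 = 0 := by rw [hF₁.reg 4 rfl]; simp [hreg]
  rw [wp_store, g0, g2]
  set s₂ := s₁.setArr 4 n 0 n with hs₂
  have a : ∀ x, x ≠ 4 → s₂.arr x = s₁.arr x := by
    intro x hx
    funext p q
    simp [s₂, hx]
  -- Doubling `D` lowers `3 * X - 2 * D` by `2 * D`, more than the failed phase costs. As `D ≤ X`,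
  -- at least `D` is left for a successful phase.
  refine (wp_while (fun s' => Idle n A s' ∧ (s'.reg 4 = 1 ∧ Closed n A s' ∨
      s'.reg 4 = 0 ∧ 0 < s'.reg 1 ∧ s'.reg 1 ≤ X ∧ ∀ i j, s'.arr 1 i j = 0))
    (fun s' => if s'.reg 4 = 0 then 170 * (n ^ 2 * (3 * X - 2 * s'.reg 1)) else 0) ?_ ?_).mono ?_
  · refine ⟨⟨g0, g2, g3, ?_, by simp [s₂], ?_⟩, .inr ⟨g4, ?_, ?_, ?_⟩⟩
    · rw [a 0 (by decide), hF₁.arr 0 rfl, ← hA0]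
      rfl
    · rw [a 2 (by decide)]
      exact hl
    · simp [s₂, g1]
    · simp only [s₂, RState.setArr_reg, g1]
      omega
    · rw [a 1 (by decide), hF₁.arr 1 rfl]
      exact h0
  · rintro s' ⟨hI, hc⟩ hh -
    simp only [RTest.Holds, hI.reg2] at hh
    obtain ⟨-, hD, hDX, hz⟩ := hc.resolve_left fun h => by omega
    refine (wp_phase hn hD hI rfl hA hz).mono ?_
    rintro t s'' - ⟨ht, hI', ⟨h4, hcl⟩ | ⟨h4, h1, ho, hS₁, hS₂⟩⟩
    · refine ⟨⟨hI', .inl ⟨h4, hcl⟩⟩, ?_⟩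
      simp only [h4, hh, if_true, one_ne_zero, if_false]
      refine ht.trans (Nat.mul_le_mul_left _ (Nat.mul_le_mul_left _ ?_))
      omega
    · have hb := hS _ hS₁ hS₂
      refine ⟨⟨hI', .inr ⟨h4, by omega, by omega, by rwa [ho]⟩⟩, ?_⟩
      simp only [h4, hh, if_true, h1]
      refine (Nat.add_le_add_right ht _).trans ?_
      rw [← Nat.mul_add, ← Nat.mul_add]
      refine Nat.mul_le_mul_left _ (Nat.mul_le_mul_left _ ?_)
      omega
  · rintro t s' - ⟨⟨hI, hc⟩, hh, ht⟩
    simp only [RTest.Holds, hI.reg2] at hh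
    refine ⟨?_, hI, (hc.resolve_right fun h => hh h.1).2⟩
    have e4 : s₂.reg 4 = 0 := g4
    simp only [e4, if_true] at ht
    have h1 : n ^ 2 * (3 * X - 2 * s₂.reg 1) ≤ n ^ 2 * (3 * X) := Nat.mul_le_mul_left _ (by omega)
    have e5 : n ^ 2 * (3 * X) = 3 * (n ^ 2 * X) := by ring
    have q1 : n ≤ n ^ 2 * X := by nlinarith [Nat.mul_le_mul hn hX, Nat.mul_le_mul_left (n ^ 2) hX]
    omega

/-- Compute the transitive closure and set its diagonal to one. -/
def reflTransClosureProg : RProg := .seq transClosureProg (forLoop 7 0 (.store 1 7 7 3))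

end RProg

/-! ### Boolean matrices as inputs -/

namespace BoolMat

variable {n : ℕ}

theorem rowDist_eq (C : BoolMat n) {A : ℕ → ℕ → ℕ} (hA : ∀ i j : Fin n, A i j = (C i j).toNat)
    (i j : Fin n) : rowDist n A i j = hammingDist (C i) (C j) := by
  rw [rowDist, hammingDist, ← Finset.card_map Fin.valEmbedding]
  congr 1
  ext k
  simp only [Finset.mem_filter, Finset.mem_range, Finset.mem_map, Finset.mem_univ, true_and,
    Fin.valEmbedding_apply]
  have hinj : ∀ a b : Bool, a.toNat = b.toNat ↔ a = b := by decide
  constructor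
  · rintro ⟨hk, h⟩
    have := hA i ⟨k, hk⟩
    have := hA j ⟨k, hk⟩
    refine ⟨⟨k, hk⟩, ?_, rfl⟩
    rw [ne_eq, ← hinj, ← hA, ← hA]
    exact h
  · rintro ⟨k, h, rfl⟩
    refine ⟨k.2, ?_⟩
    rw [hA, hA, ne_eq, hinj]
    exact h

/-- The radius `(D + 1) / 2` is at least `D / 2`, which explains the factor two. -/
theorem le_MWT_of_scattered (C : BoolMat n) {A : ℕ → ℕ → ℕ}
    (hA : ∀ i j : Fin n, A i j = (C i j).toNat) {D : ℕ} (h : RProg.Scattered n D A) :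
    D * D ≤ 2 * C.MWT := by
  obtain ⟨Z, hZ, hcard, hsep⟩ := h
  have := C.le_MWT_of_separated (Z.attachFin hZ) (D := D) (by simpa using hcard) ?_
  · have h2 : D ≤ 2 * ((D + 1) / 2) := by omega
    calc D * D ≤ D * (2 * ((D + 1) / 2)) := Nat.mul_le_mul_left _ h2
      _ = 2 * (D * ((D + 1) / 2)) := by ring
      _ ≤ _ := Nat.mul_le_mul_left _ this
  · intro u hu v hv huv
    rw [← C.rowDist_eq hA]
    exact hsep _ (by simpa using hu) _ (by simpa using hv) (by simpa [Fin.ext_iff] using huv)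

theorem init_arr_apply (B : BoolMat n) (i j : Fin n) :
    (RState.init B).arr 0 i j = (B i j).toNat := by
  simp [RState.init]

theorem lt_of_init_arr (B : BoolMat n) (i j : ℕ) (h : (RState.init B).arr 0 i j = 1) :
    i < n ∧ j < n := by
  by_contra h'
  simp [RState.init, h'] at h

/-- A path in the array cannot leave the range below `n`, as entries outside are zero. -/
theorem transGen_init_iff (B : BoolMat n) (i j : Fin n) :
    Relation.TransGen ((RState.init B).arr 0 · · = 1) (i : ℕ) j ↔
      Relation.TransGen (fun u v => B u v = true) i j := by
  have hone : ∀ b : Bool, b.toNat = 1 ↔ b = true := by decide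
  constructor
  · intro h
    suffices H : ∀ k, Relation.TransGen ((RState.init B).arr 0 · · = 1) (i : ℕ) k →
        ∀ hk : k < n, Relation.TransGen (fun u v => B u v = true) i ⟨k, hk⟩ from H j h j.2
    intro k hk
    induction hk with
    | single h =>
      intro hk
      refine .single ?_
      rwa [← hone, ← init_arr_apply]
    | tail _ h ih =>
      intro hk
      refine (ih (B.lt_of_init_arr _ _ h).1).tail ?_
      rwa [← hone, ← init_arr_apply]
  · intro h
    refine h.lift (fun k : Fin n => (k : ℕ)) fun a b hab => ?_
    show (RState.init B).arr 0 a b = 1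
    rw [init_arr_apply, hab]
    rfl

/-- A bound for the thresholds that occur in the computation. -/
noncomputable def thresholdBound (B : BoolMat n) : ℕ :=
  1 + 2 * Nat.sqrt (2 * min B.MWT (MWT B.transpose))

theorem thresholdBound_le (B : BoolMat n) (hn : 0 < n) : (B.thresholdBound : ℝ) ≤
    4 * √((n : ℝ) + (min B.MWT (MWT B.transpose) : ℕ)) := by
  set M := min B.MWT (MWT B.transpose) with hM
  have h1 : (1 : ℝ) ≤ n := by exact_mod_cast hn
  have h2 : (0 : ℝ) ≤ (M : ℕ) := Nat.cast_nonneg _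
  set y := √((n : ℝ) + (M : ℕ)) with hy
  have hyy : y * y = n + (M : ℕ) := Real.mul_self_sqrt (by positivity)
  have hy1 : 1 ≤ y := Real.one_le_sqrt.mpr (by linarith)
  have h3 : ((Nat.sqrt (2 * M) : ℕ) : ℝ) * (Nat.sqrt (2 * M) : ℕ) ≤ 2 * (M : ℕ) := by
    exact_mod_cast Nat.sqrt_le (2 * M)
  -- `3 / 2` is a rational bound for `√2`; as `1 ≤ y`, the final estimate is `1 + 2 * (3 / 2 * y) ≤
  -- 4 * y`.
  have h4 : ((Nat.sqrt (2 * M) : ℕ) : ℝ) ≤ 3 / 2 * y := by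
    refine abs_le_of_sq_le_sq' ?_ (by positivity) |>.2
    nlinarith
  rw [thresholdBound, ← hM]
  push_cast
  linarith

end BoolMat

/-! ### Correctness on an input matrix, and the probability of success -/

namespace RProg

variable {n : ℕ} {ω : ℕ → Bool}

theorem wp_transClosureProg_init (B : BoolMat n) (hn : 0 < n) :
    Wp ω transClosureProg (RState.init B) fun t s' => t ≤ 520 * (n ^ 2 * B.thresholdBound) ∧
      Idle n ((RState.init B).arr 0) s' ∧ s'.Outputs B.transClosure := by
  classical
  refine (wp_transClosureProg (X := B.thresholdBound) hn (by simp [BoolMat.thresholdBound]) rfl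
    rfl B.lt_of_init_arr (by simp [RState.init]) ?_).mono ?_
  · intro D h h'
    have h1 := B.le_MWT_of_scattered B.init_arr_apply h
    have h2 := BoolMat.le_MWT_of_scattered B.transpose (fun i j => B.init_arr_apply j i) h'
    -- Failure of both clusterings bounds `D * D` by twice either weight, hence by twice the
    -- minimum.
    have : D ≤ Nat.sqrt (2 * min B.MWT (BoolMat.MWT B.transpose)) := by
      rw [Nat.le_sqrt]
      omega
    rw [BoolMat.thresholdBound]
    omega
  · rintro t s' - ⟨ht, hI, hC⟩
    refine ⟨ht, hI, fun i j => ?_⟩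
    rw [hC i i.2 j j.2, BoolMat.transClosure_apply, B.transGen_init_iff]
    split_ifs with h <;> simp [h]

theorem wp_reflTransClosureProg_init (B : BoolMat n) (hn : 0 < n) :
    Wp ω reflTransClosureProg (RState.init B) fun t s' =>
      t ≤ 525 * (n ^ 2 * B.thresholdBound) ∧ s'.Outputs B.reflTransClosure := by
  classical
  rw [reflTransClosureProg, wp_seq]
  refine (wp_transClosureProg_init B hn).mono ?_
  rintro t s - ⟨ht, hI, hO⟩
  -- The two closures agree off the diagonal, so only diagonal entries are overwritten.
  refine (wp_forLoop (N := n) (T := 1) (fun i s' => (∀ j < i, s'.arr 1 j j = 1) ∧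
    ∀ j k, (j ≠ k ∨ i ≤ j) → s'.arr 1 j k = s.arr 1 j k)
    (fun _ => 0) rfl rfl hI.reg0 (by simp) ?_).mono ?_
  · rintro i s' hi h7 - hF ⟨hl, hr⟩
    simp only [wp_store, h7, hF.reg 3 rfl, hI.reg3]
    refine ⟨⟨fun j hj => ?_, fun j k hjk => ?_⟩, by omega⟩
    · simp only [RState.setReg_arr, RState.setArr_arr]
      split_ifs with h
      · rfl
      · exact hl j (by simp at h; omega)
    · simp only [RState.setReg_arr, RState.setArr_arr]
      rw [if_neg (by omega)]
      exact hr j k (by omega)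
  · rintro t' s' - ⟨⟨hl, hr⟩, ht'⟩
    have q1 : n ≤ n ^ 2 * B.thresholdBound := by
      have hX : 0 < B.thresholdBound := by simp [BoolMat.thresholdBound]
      nlinarith [Nat.mul_le_mul hn hX, Nat.mul_le_mul_left (n ^ 2) hX]
    refine ⟨by omega, fun i j => ?_⟩
    rw [BoolMat.reflTransClosure_apply]
    by_cases hij : i = j
    · subst hij
      rw [hl i i.2, decide_eq_true Relation.ReflTransGen.refl]
      rfl
    · rw [hr i j (.inl fun h => hij (Fin.ext h)), hO i j, BoolMat.transClosure_apply,
        Relation.reflTransGen_iff_eq_or_transGen]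
      simp [Ne.symm hij]

/-- The event is the whole space, so no measurability has to be checked. -/
theorem successProb_eq_one {P : RProg} {B D : BoolMat n} {T : ℝ}
    (h : ∀ ω, Wp ω P (RState.init B) fun t s => (t : ℝ) ≤ T ∧ s.Outputs D) :
    successProb P B D T = 1 := by
  have : IsProbabilityMeasure coinFlips := by
    unfold coinFlips
    infer_instance
  have hu : {ω | ∃ (t : ℕ) (s : RState), Exec ω P (RState.init B) t s ∧ (t : ℝ) ≤ T ∧
      s.Outputs D} = Set.univ := Set.eq_univ_of_forall h
  rw [successProb, hu, probReal_univ]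

/-- `2100 = 525 * 4`, with the factor `4` of `thresholdBound_le`; no logarithm is lost, so the
exponent is `0`. -/
theorem le_timeBound (B : BoolMat n) (hn : 0 < n) {t : ℕ}
    (ht : t ≤ 525 * (n ^ 2 * B.thresholdBound)) : (t : ℝ) ≤ timeBound 2100 0 B := by
  have h1 : (t : ℝ) ≤ 525 * ((n : ℝ) ^ 2 * B.thresholdBound) := by exact_mod_cast ht
  have h2 := mul_le_mul_of_nonneg_left (B.thresholdBound_le hn) (sq_nonneg (n : ℝ))
  rw [timeBound, pow_zero, mul_one]
  linarith

theorem successProb_transClosureProg (B : BoolMat n) (hn : 0 < n) :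
    successProb transClosureProg B B.transClosure (timeBound 2100 0 B) = 1 :=
  successProb_eq_one fun _ => (wp_transClosureProg_init B hn).mono fun _ _ _ h =>
    ⟨le_timeBound B hn (by omega), h.2.2⟩

theorem successProb_reflTransClosureProg (B : BoolMat n) (hn : 0 < n) :
    successProb reflTransClosureProg B B.reflTransClosure (timeBound 2100 0 B) = 1 :=
  successProb_eq_one fun _ => (wp_reflTransClosureProg_init B hn).mono fun _ _ _ h =>
    ⟨le_timeBound B hn h.1, h.2⟩

end RProg

theorem mainTheorem3 (α : ℝ) (hα : 1 ≤ α) :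
    (∃ (P : RProg) (C : ℝ) (k : ℕ), ∀ n : ℕ, 0 < n →
      (∀ G : Digraph (Fin n),
        1 - 1 / (n : ℝ) ^ α ≤
          successProb P G.boolAdj G.transClosure.boolAdj (timeBound C k G.boolAdj)) ∧
      (∀ B : BoolMat n,
        1 - 1 / (n : ℝ) ^ α ≤
          successProb P B B.transClosure (timeBound C k B))) ∧
    (∃ (P : RProg) (C : ℝ) (k : ℕ), ∀ n : ℕ, 0 < n →
      (∀ G : Digraph (Fin n),
        1 - 1 / (n : ℝ) ^ α ≤
          successProb P G.boolAdj G.reflTransClosure.boolAdj (timeBound C k G.boolAdj)) ∧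
      (∀ B : BoolMat n,
        1 - 1 / (n : ℝ) ^ α ≤
          successProb P B B.reflTransClosure (timeBound C k B))) := by
  have hle : ∀ n : ℕ, 1 - 1 / (n : ℝ) ^ α ≤ 1 := fun n => sub_le_self 1 (by positivity)
  refine ⟨⟨RProg.transClosureProg, 2100, 0, fun n hn => ⟨fun G => ?_, fun B => ?_⟩⟩,
    ⟨RProg.reflTransClosureProg, 2100, 0, fun n hn => ⟨fun G => ?_, fun B => ?_⟩⟩⟩
  · rw [G.boolAdj_transClosure, RProg.successProb_transClosureProg _ hn]
    exact hle n
  · rw [RProg.successProb_transClosureProg _ hn]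
    exact hle n
  · rw [G.boolAdj_reflTransClosure, RProg.successProb_reflTransClosureProg _ hn]
    exact hle n
  · rw [RProg.successProb_reflTransClosureProg _ hn]
    exact hle n
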